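/- \textbf{Theorem (existence and uniqueness of the BPS multi-vortex soliton).} Let $n\ge 0$ be an integer, let $x_1,\dots,x_n\in\mathbb{R}^2$ be arbitrary (not necessarily distinct) points, and let $\lambda>4n$ be a real number. Define the background functions \[ u_0(x)=-\ln\prod_{a=1}^{n}\Bigl(1+\frac{\lambda}{|x-x_a|^2}\Bigr),\qquad g_0(x)=\sum_{a=1}^{n}\frac{4\lambda}{(|x-x_a|^2+\lambda)^2}. \] Let $\varsigma\in L^2(\mathbb{R}^2)$ be a real function with \[ \|\varsigma\|_2=\Bigl(\int_{\mathbb{R}^2}|\varsigma|^2\,d^2x\Bigr)^{1/2}<\sqrt{\frac{2}{\pi}}. \] Then the equation \[ \nabla^2u=e^{u+u_0}+g_0-\varsigma-1\quad\text{on }\mathbb{R}^2 \] has exactly one weak solution $u\in W^{1,2}(\mathbb{R}^2)$ (up to equality almost everywhere). Moreover $u$ has a continuous representative, which satisfies the boundary condition $u(x)\to0$ as $|x|\to\infty$. Here $u\in W^{1,2}(\mathbb{R}^2)$ means that $u$ and its weak gradient $\nabla u$ are square integrable, and $u$ is a weak solution if the right-hand side $F=e^{u+u_0}+g_0-\varsigma-1$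 is locally integrable and $\int\nabla u\cdot\nabla\varphi\,d^2x=-\int F\varphi\,d^2x$ for all $\varphi\in C_c^\infty(\mathbb{R}^2)$. -/

import Mathlib

open MeasureTheory
open scoped ContDiff

noncomputable section

namespace BPSVortex

/-- The plane `ℝ²` with its Euclidean norm and Lebesgue measure. -/
abbrev Plane : Type := EuclideanSpace ℝ (Fin 2)

/-- Test functions: smooth real functions with compact support. -/
def IsTestFunction (φ : Plane → ℝ) : Prop :=
  ContDiff ℝ ∞ φ ∧ HasCompactSupport φ

/-- The locally integrable vector field `G` is the weak gradient of the locally integrable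
function `u`: `∫ u ∂ᵢφ = -∫ Gᵢ φ` for every test function `φ` and each coordinate `i`. -/
def HasWeakGradient (u : Plane → ℝ) (G : Plane → Plane) : Prop :=
  LocallyIntegrable u volume ∧ LocallyIntegrable G volume ∧
    ∀ φ : Plane → ℝ, IsTestFunction φ → ∀ i : Fin 2,
      ∫ x, u x * fderiv ℝ φ x (EuclideanSpace.single i 1) = -∫ x, G x i * φ x

/-- `u ∈ W^{1,2}(ℝ²)`: `u` is square integrable, with a square integrable weak gradient. -/
def MemW12 (u : Plane → ℝ) : Prop :=
  MemLp u 2 volume ∧ ∃ G : Plane → Plane, HasWeakGradient u G ∧ MemLp G 2 volume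

/-- `u` is a weak solution of `∇²u = F`: the right-hand side is locally integrable, and
`∫ ∇u · ∇φ = -∫ F φ` for every test function `φ`, with `∇u` the weak gradient. -/
def IsWeakSolution (u F : Plane → ℝ) : Prop :=
  LocallyIntegrable F volume ∧
    ∃ G : Plane → Plane, HasWeakGradient u G ∧
      ∀ φ : Plane → ℝ, IsTestFunction φ →
        ∫ x, inner ℝ (G x) (gradient φ x) = -∫ x, F x * φ x

/-- The background function `u₀ = -ln ∏ₐ (1 + λ / |x - xₐ|²)`. (At the finitely many points
`xₐ`, where `u₀ = -∞`, the value given by this formula is irrelevant.) -/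
def u₀ {n : ℕ} (lam : ℝ) (p : Fin n → Plane) (x : Plane) : ℝ :=
  -Real.log (∏ a, (1 + lam / ‖x - p a‖ ^ 2))

/-- The background function `g₀ = ∑ₐ 4λ / (|x - xₐ|² + λ)²`. -/
def g₀ {n : ℕ} (lam : ℝ) (p : Fin n → Plane) (x : Plane) : ℝ :=
  ∑ a, 4 * lam / (‖x - p a‖ ^ 2 + lam) ^ 2

/-- `u ∈ W^{1,2}(ℝ²)` is a weak solution of the multi-vortex equation
`∇²u = e^{u + u₀} + g₀ - ς - 1`. -/
def IsVortexSolution {n : ℕ} (lam : ℝ) (p : Fin n → Plane) (ς u : Plane → ℝ) : Prop :=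
  MemW12 u ∧
    IsWeakSolution u (fun x => Real.exp (u x + u₀ lam p x) + g₀ lam p x - ς x - 1)

end BPSVortex

end

/-! Write `w = exp u₀`, so that `0 < w ≤ 1` with `1 - w ∈ L²`, and `r = 1 - w - g₀ + ς ∈ L²`. The
equation becomes `Δu = w (e^u - 1) - r`, whose right-hand side is increasing in `u`.

*Uniqueness* is the comparison principle `HasWeakLaplacian.ae_nonpos`: if `d ∈ L²(ℝ²)` has a locally
integrable distributional Laplacian which is positive wherever `d` is positive, then `d ≤ 0`. It
follows from Kato's inequality `HasWeakLaplacian.kato_le`, proved by mollification and Fatou's lemma,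
tested against the dilations of a cutoff, whose contribution vanishes in the limit because `d ∈ L²`.
Only local integrability of the exponential is needed.

*Existence* is a monotone iteration (`exists_solution_of_barriers`) between a subsolution and a
supersolution, with the operator `(κ - Δ)⁻¹`, built by Fourier transform in `exists_resolvent`. In
dimension two the symbol `1 / (κ + 4π²|ξ|²)` is square integrable, so `(κ - Δ)⁻¹` maps `L²` to
continuous functions vanishing at infinity; its monotonicity is again the comparison principle.
The barriers (`exists_barrier`) are `± (ε - Δ)⁻¹(r^± + s 1_B)`, where `B = {w < 1/2}` has finite
measure: outside `B` the potential `w` dominates `ε`, and inside `B` the extra source `s` does the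
work. This is consistent because the norm of `ε(ε - Δ)⁻¹ : L² → L^∞` tends to `0` with `ε`
(`tendsto_mul_supBound`). Continuity and decay of the solution come for free, since the limit of the
iteration is itself of the form `(κ - Δ)⁻¹ρ` with `ρ ∈ L²`. -/

noncomputable section

namespace BPSVortex

open Filter Topology Convolution FourierTransform
open scoped SchwartzMap LineDeriv

/-! ### Integration by parts and the smooth Kato inequality -/

/-- The Laplacian `∂₁²φ + ∂₂²φ`, written with the partial derivatives of the weak formulation. -/
def lap (φ : Plane → ℝ) (x : Plane) : ℝ :=
  ∑ i : Fin 2, fderiv ℝ (fun y => fderiv ℝ φ y (EuclideanSpace.single i 1)) x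
    (EuclideanSpace.single i 1)

theorem contDiff_fderiv_apply {φ : Plane → ℝ} {n : ℕ∞} (h : ContDiff ℝ (n + 1 : ℕ∞) φ) (v : Plane) :
    ContDiff ℝ n (fun y => fderiv ℝ φ y v) :=
  (h.fderiv_right (m := n) le_rfl).clm_apply contDiff_const

theorem IsTestFunction.fderiv_apply {φ : Plane → ℝ} (h : IsTestFunction φ) (v : Plane) :
    IsTestFunction (fun y => fderiv ℝ φ y v) :=
  ⟨contDiff_fderiv_apply (n := ⊤) (by simpa using h.1) v, h.2.fderiv_apply ℝ v⟩

theorem isTestFunction_lap {φ : Plane → ℝ} (h : IsTestFunction φ) : IsTestFunction (lap φ) := by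
  have h' := fun i : Fin 2 => (h.fderiv_apply (EuclideanSpace.single i 1)).fderiv_apply
    (EuclideanSpace.single i 1)
  refine ⟨ContDiff.sum fun i _ => (h' i).1, ?_⟩
  have : lap φ = (fun y => fderiv ℝ (fun y => fderiv ℝ φ y (EuclideanSpace.single 0 1)) y
      (EuclideanSpace.single 0 1)) + (fun y => fderiv ℝ (fun y => fderiv ℝ φ y
      (EuclideanSpace.single 1 1)) y (EuclideanSpace.single 1 1)) := by
    ext x; simp [lap, Fin.sum_univ_two]
  rw [this]
  exact (h' 0).2.add (h' 1).2

theorem integral_mul_fderiv_of_hasCompactSupport {f g : Plane → ℝ} (hf : ContDiff ℝ 1 f)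
    (hg : ContDiff ℝ 1 g) (hc : HasCompactSupport g) (v : Plane) :
    ∫ x, f x * fderiv ℝ g x v = -∫ x, fderiv ℝ f x v * g x := by
  have hf' : Continuous fun x => fderiv ℝ f x v :=
    (contDiff_fderiv_apply (n := 0) (by simpa using hf) v).continuous
  have hg' : Continuous fun x => fderiv ℝ g x v :=
    (contDiff_fderiv_apply (n := 0) (by simpa using hg) v).continuous
  apply integral_mul_fderiv_eq_neg_fderiv_mul_of_integrable
  · exact (hf'.mul hg.continuous).integrable_of_hasCompactSupport hc.mul_left
  · exact (hf.continuous.mul hg').integrable_of_hasCompactSupport (hc.fderiv_apply ℝ v).mul_left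
  · exact (hf.continuous.mul hg.continuous).integrable_of_hasCompactSupport hc.mul_left
  · exact fun x _ => hf.differentiable one_ne_zero x
  · exact fun x _ => hg.differentiable one_ne_zero x

/-- The primitive of `expNegInvGlue` vanishing at `0`: a convex function which is positive on
`(0, ∞)`, zero on `(-∞, 0]`, and has slope in `[0, 1]`. -/
def kato (s : ℝ) : ℝ := ∫ t in (0 : ℝ)..s, expNegInvGlue t

theorem expNegInvGlue_le_one (s : ℝ) : expNegInvGlue s ≤ 1 := by
  rcases le_or_gt s 0 with h | h
  · simp [expNegInvGlue, h]
  · simp [expNegInvGlue, h.not_ge, h.le]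

theorem hasDerivAt_kato (s : ℝ) : HasDerivAt kato (expNegInvGlue s) s :=
  intervalIntegral.integral_hasDerivAt_right
    ((expNegInvGlue.contDiff (n := 0)).continuous.intervalIntegrable _ _)
    ((expNegInvGlue.contDiff (n := 0)).continuous.stronglyMeasurableAtFilter _ _)
    (expNegInvGlue.contDiff (n := 0)).continuous.continuousAt

theorem contDiff_kato : ContDiff ℝ 2 kato := by
  rw [show (2 : WithTop ℕ∞) = 1 + 1 by norm_num, contDiff_succ_iff_deriv]
  refine ⟨fun s => (hasDerivAt_kato s).differentiableAt, by simp, ?_⟩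
  rw [show deriv kato = expNegInvGlue from funext fun s => (hasDerivAt_kato s).deriv]
  exact expNegInvGlue.contDiff (n := 1)

theorem abs_kato_le (s : ℝ) : |kato s| ≤ |s| := by
  have := intervalIntegral.norm_integral_le_of_norm_le_const (a := 0) (b := s) (C := 1)
    (f := expNegInvGlue) fun x _ => by
      rw [Real.norm_eq_abs, abs_of_nonneg (expNegInvGlue.nonneg x)]
      exact expNegInvGlue_le_one x
  simpa [kato] using this

/-- Kato's inequality for smooth `D`: since `kato` is convex, `Δ(kato ∘ D) ≥ kato'(D) ΔD`, tested
against a nonnegative `χ`. -/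
theorem kato_smooth {D χ : Plane → ℝ} (hD : ContDiff ℝ 2 D) (hχ : IsTestFunction χ)
    (hχ0 : ∀ x, 0 ≤ χ x) :
    ∫ x, lap D x * expNegInvGlue (D x) * χ x ≤ ∫ x, kato (D x) * lap χ x := by
  have hT : ContDiff ℝ 1 expNegInvGlue := expNegInvGlue.contDiff (n := 1)
  have hD1 : ContDiff ℝ 1 D := hD.of_le (by norm_num)
  have hTD : ContDiff ℝ 1 (fun x => expNegInvGlue (D x)) := hT.comp hD1
  have hKD : ContDiff ℝ 1 (fun x => kato (D x)) :=
    (contDiff_kato.of_le (by norm_num)).comp hD1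
  have hdD : ∀ v, ContDiff ℝ 1 (fun x => fderiv ℝ D x v) := fun v =>
    contDiff_fderiv_apply (n := 1) (by simpa [one_add_one_eq_two] using hD) v
  have hddD : ∀ v, Continuous (fun x => fderiv ℝ (fun y => fderiv ℝ D y v) x v) := fun v =>
    (contDiff_fderiv_apply (n := 0) (by simpa using hdD v) v).continuous
  have hfK : ∀ x v, fderiv ℝ (fun x => kato (D x)) x v = expNegInvGlue (D x) * fderiv ℝ D x v := by
    intro x v
    have := (hasDerivAt_kato (D x)).comp_hasFDerivAt x
      (hD1.differentiable one_ne_zero x).hasFDerivAt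
    rw [show (fun x => kato (D x)) = kato ∘ D from rfl, this.fderiv]; simp
  have hfT : ∀ x v, fderiv ℝ (fun x => expNegInvGlue (D x) * fderiv ℝ D x v) x v
      = deriv expNegInvGlue (D x) * (fderiv ℝ D x v) ^ 2
        + expNegInvGlue (D x) * fderiv ℝ (fun y => fderiv ℝ D y v) x v := by
    intro x v
    have h1 := (hT.differentiable one_ne_zero (D x)).hasDerivAt.comp_hasFDerivAt x
      (hD1.differentiable one_ne_zero x).hasFDerivAt
    have h2 := h1.mul ((hdD v).differentiable one_ne_zero x).hasFDerivAt
    rw [show (fun x => expNegInvGlue (D x) * fderiv ℝ D x v)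
      = (expNegInvGlue ∘ D) * (fun y => fderiv ℝ D y v) from rfl, h2.fderiv]
    simp; ring
  have hTD' : ∀ v, ContDiff ℝ 1 (fun x => expNegInvGlue (D x) * fderiv ℝ D x v) := fun v =>
    hTD.mul (hdD v)
  have key : ∀ v, ∫ x, fderiv ℝ (fun y => fderiv ℝ D y v) x v * expNegInvGlue (D x) * χ x
      ≤ ∫ x, kato (D x) * fderiv ℝ (fun y => fderiv ℝ χ y v) x v := by
    intro v
    have hχ1 := hχ.fderiv_apply v
    rw [integral_mul_fderiv_of_hasCompactSupport hKD (hχ1.1.of_le (by simp)) hχ1.2 v]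
    simp_rw [hfK]
    rw [integral_mul_fderiv_of_hasCompactSupport (hTD' v) (hχ.1.of_le (by simp)) hχ.2 v, neg_neg]
    refine integral_mono ?_ ?_ ?_
    · exact (((hddD v).mul hTD.continuous).mul hχ.1.continuous).integrable_of_hasCompactSupport
        hχ.2.mul_left
    · have : Continuous fun x => fderiv ℝ (fun x => expNegInvGlue (D x) * fderiv ℝ D x v) x v :=
        (contDiff_fderiv_apply (n := 0) (by simpa using hTD' v) v).continuous
      exact (this.mul hχ.1.continuous).integrable_of_hasCompactSupport hχ.2.mul_left
    · intro x
      simp only [hfT]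
      have : 0 ≤ deriv expNegInvGlue (D x) := expNegInvGlue.monotone.deriv_nonneg
      have := mul_nonneg (mul_nonneg this (sq_nonneg (fderiv ℝ D x v))) (hχ0 x)
      linarith
  have hI1 : ∀ i ∈ (Finset.univ : Finset (Fin 2)), Integrable fun x =>
      fderiv ℝ (fun y => fderiv ℝ D y (EuclideanSpace.single i 1)) x (EuclideanSpace.single i 1)
        * expNegInvGlue (D x) * χ x := fun i _ =>
    (((hddD _).mul hTD.continuous).mul hχ.1.continuous).integrable_of_hasCompactSupport
        hχ.2.mul_left
  have hI2 : ∀ i ∈ (Finset.univ : Finset (Fin 2)), Integrable fun x =>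
      kato (D x) * fderiv ℝ (fun y => fderiv ℝ χ y (EuclideanSpace.single i 1)) x
        (EuclideanSpace.single i 1) := fun i _ =>
    (hKD.continuous.mul ((hχ.fderiv_apply _).fderiv_apply _).1.continuous
      ).integrable_of_hasCompactSupport ((hχ.fderiv_apply _).fderiv_apply _).2.mul_left
  simp only [lap, Finset.mul_sum, Finset.sum_mul]
  rw [integral_finsetSum _ hI1, integral_finsetSum _ hI2]
  exact Finset.sum_le_sum fun i _ => key _

/-! ### Mollification -/

/-- The convolution `(k ⋆ u)(x) = ∫ k(x - t) u(t) dt` of two real functions on the plane. -/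
abbrev conv (k u : Plane → ℝ) : Plane → ℝ := k ⋆[ContinuousLinearMap.lsmul ℝ ℝ, volume] u

theorem conv_apply (k u : Plane → ℝ) (x : Plane) : conv k u x = ∫ t, k (x - t) * u t := by
  rw [conv, convolution_lsmul_swap]; rfl

/-- `g` is the distributional Laplacian of `u`. -/
def HasWeakLaplacian (u g : Plane → ℝ) : Prop :=
  LocallyIntegrable u volume ∧ LocallyIntegrable g volume ∧
    ∀ φ : Plane → ℝ, IsTestFunction φ → ∫ x, u x * lap φ x = ∫ x, g x * φ x

theorem integrable_mul_of_locallyIntegrable {u φ : Plane → ℝ} (hu : LocallyIntegrable u volume)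
    (hφ : Continuous φ) (hc : HasCompactSupport φ) : Integrable (fun x => φ x * u x) :=
  hu.integrable_smul_left_of_hasCompactSupport hφ hc

theorem IsTestFunction.comp_const_sub {k : Plane → ℝ} (hk : IsTestFunction k) (x : Plane) :
    IsTestFunction (fun t => k (x - t)) :=
  ⟨hk.1.comp (contDiff_const.sub contDiff_id),
    hk.2.comp_homeomorph (Homeomorph.subLeft x)⟩

theorem integrable_conv_integrand {k u : Plane → ℝ} (hk : IsTestFunction k)
    (hu : LocallyIntegrable u volume) (x : Plane) : Integrable (fun t => k (x - t) * u t) :=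
  integrable_mul_of_locallyIntegrable hu (hk.comp_const_sub x).1.continuous (hk.comp_const_sub x).2

theorem contDiff_conv {k u : Plane → ℝ} (hk : IsTestFunction k) (hu : LocallyIntegrable u volume) :
    ContDiff ℝ 2 (conv k u) :=
  hk.2.contDiff_convolution_left (n := 2) _ (hk.1.of_le (by exact_mod_cast le_top)) hu

theorem fderiv_conv {k u : Plane → ℝ} (hk : IsTestFunction k) (hu : LocallyIntegrable u volume)
    (v x : Plane) : fderiv ℝ (conv k u) x v = conv (fun y => fderiv ℝ k y v) u x := by
  have hk1 : ContDiff ℝ 1 k := hk.1.of_le (by exact_mod_cast le_top)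
  rw [conv, ← convolution_flip, (hk.2.hasFDerivAt_convolution_right _ hu hk1 x).fderiv,
    convolution_precompR_apply _ hu (hk.2.fderiv ℝ) (hk1.continuous_fderiv one_ne_zero),
    conv, convolution_flip]

theorem fderiv_comp_const_sub_apply {k : Plane → ℝ} (hk : Differentiable ℝ k) (x t v : Plane) :
    fderiv ℝ (fun t => k (x - t)) t v = -fderiv ℝ k (x - t) v := by
  have := (hk (x - t)).hasFDerivAt.comp t ((hasFDerivAt_id t).const_sub x)
  rw [show (fun t => k (x - t)) = k ∘ HSub.hSub x from rfl, this.fderiv]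
  simp

theorem lap_comp_const_sub {k : Plane → ℝ} (hk : IsTestFunction k) (x t : Plane) :
    lap (fun t => k (x - t)) t = lap k (x - t) := by
  unfold lap
  refine Finset.sum_congr rfl fun i _ => ?_
  have h1 : (fun y => fderiv ℝ (fun t => k (x - t)) y (EuclideanSpace.single i 1))
      = -fun y => fderiv ℝ k (x - y) (EuclideanSpace.single i 1) := by
    ext y; exact fderiv_comp_const_sub_apply (hk.1.differentiable (by simp)) x y _
  rw [h1, fderiv_neg, neg_apply,
    fderiv_comp_const_sub_apply ((hk.fderiv_apply _).1.differentiable (by simp)), neg_neg]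

/-- Mollification turns a distributional Laplacian into a classical one. -/
theorem HasWeakLaplacian.lap_conv {u g k : Plane → ℝ} (h : HasWeakLaplacian u g)
    (hk : IsTestFunction k) (x : Plane) : lap (conv k u) x = conv k g x := by
  have h1 : lap (conv k u) x = ∑ i : Fin 2, conv (fun y => fderiv ℝ (fun y => fderiv ℝ k y
      (EuclideanSpace.single i 1)) y (EuclideanSpace.single i 1)) u x := by
    unfold lap
    refine Finset.sum_congr rfl fun i _ => ?_
    rw [show (fun y => fderiv ℝ (conv k u) y (EuclideanSpace.single i 1))
      = conv (fun y => fderiv ℝ k y (EuclideanSpace.single i 1)) u from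
      funext fun y => fderiv_conv hk h.1 _ _, fderiv_conv (hk.fderiv_apply _) h.1]
  have h2 := h.2.2 _ (hk.comp_const_sub x)
  rw [h1, conv_apply k g]
  simp_rw [conv_apply]
  rw [← integral_finsetSum]
  · simp_rw [lap_comp_const_sub hk] at h2
    simp_rw [mul_comm (k _) (g _), ← h2]
    congr 1; ext t
    rw [lap, Finset.mul_sum]
    exact Finset.sum_congr rfl fun i _ => mul_comm _ _
  · exact fun i _ => integrable_conv_integrand ((hk.fderiv_apply _).fderiv_apply _) h.1 x

theorem isTestFunction_normed (f : ContDiffBump (0 : Plane)) :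
    IsTestFunction (f.normed volume) :=
  ⟨f.contDiff_normed, f.hasCompactSupport_normed⟩

theorem abs_conv_normed_le (f : ContDiffBump (0 : Plane)) (u : Plane → ℝ) (x : Plane) :
    |conv (f.normed volume) u x| ≤ conv (f.normed volume) (fun t => |u t|) x := by
  simp_rw [conv_apply]
  refine (abs_integral_le_integral_abs).trans_eq ?_
  simp_rw [abs_mul, abs_of_nonneg (f.nonneg_normed _)]

theorem abs_conv_normed_le_of_bound (f : ContDiffBump (0 : Plane)) {u : Plane → ℝ} {C : ℝ}
    (hu : ∀ x, |u x| ≤ C) (x : Plane) : |conv (f.normed volume) u x| ≤ C := by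
  rw [conv, convolution_lsmul]
  calc |∫ t, f.normed volume t • u (x - t)|
      ≤ ∫ t, f.normed volume t * C := by
        rw [← Real.norm_eq_abs]
        refine norm_integral_le_of_norm_le (f.integrable_normed.mul_const C) (ae_of_all _ fun t => ?_)
        rw [norm_smul, Real.norm_of_nonneg (f.nonneg_normed _)]
        exact mul_le_mul_of_nonneg_left (hu _) (f.nonneg_normed _)
    _ = C := by rw [integral_mul_const, f.integral_normed, one_mul]

/-- Convolution with an even kernel is symmetric for the pairing of functions. -/
theorem integral_conv_normed_mul (f : ContDiffBump (0 : Plane)) {h ψ : Plane → ℝ}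
    (hh : LocallyIntegrable h volume) (hψ : Continuous ψ) (hc : HasCompactSupport ψ) :
    ∫ x, conv (f.normed volume) h x * ψ x = ∫ t, conv (f.normed volume) ψ t * h t := by
  set k := f.normed volume with hk
  have hkc : Continuous k := (isTestFunction_normed f).1.continuous
  obtain ⟨C, hC⟩ := (isTestFunction_normed f).2.exists_bound_of_continuous hkc
  -- the integrand is supported where `t` is within the support radius of `supp ψ`
  set K : Set Plane := Metric.cthickening f.rOut (tsupport ψ) with hK
  have hKc : IsCompact K := hc.isCompact.cthickening
  have hint : Integrable (fun z : Plane × Plane => k (z.1 - z.2) * h z.2 * ψ z.1)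
      (volume.prod volume) := by
    have h1 : Integrable (fun z : Plane × Plane => (C * |ψ z.1|) * (K.indicator (fun t => |h t|) z.2))
        (volume.prod volume) := by
      refine Integrable.mul_prod (f := fun x => C * |ψ x|) (g := K.indicator (fun t => |h t|)) ?_ ?_
      · exact ((hψ.integrable_of_hasCompactSupport hc).abs).const_mul C
      · exact (integrable_indicator_iff hKc.isClosed.measurableSet).2
          (hh.integrableOn_isCompact hKc).abs
    refine h1.mono' ?_ (ae_of_all _ fun z => ?_)
    · refine AEStronglyMeasurable.mul (AEStronglyMeasurable.mul ?_ ?_) ?_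
      · exact (hkc.comp (continuous_fst.sub continuous_snd)).aestronglyMeasurable
      · exact hh.aestronglyMeasurable.comp_snd
      · exact (hψ.comp continuous_fst).aestronglyMeasurable
    · rw [norm_mul, norm_mul, Real.norm_eq_abs (h _), Real.norm_eq_abs (ψ _)]
      by_cases hz : ψ z.1 = 0
      · simp [hz]
      by_cases hz2 : z.2 ∈ K
      · rw [Set.indicator_of_mem hz2]
        have := mul_le_mul_of_nonneg_right (hC (z.1 - z.2))
          (mul_nonneg (abs_nonneg (h z.2)) (abs_nonneg (ψ z.1)))
        linarith
      · rw [Set.indicator_of_notMem hz2]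
        have : k (z.1 - z.2) = 0 := by
          by_contra hne
          apply hz2
          have h1 : z.1 - z.2 ∈ Metric.ball (0 : Plane) f.rOut := by
            rw [← f.support_normed_eq (μ := volume)]; exact hne
          refine Metric.mem_cthickening_of_dist_le z.2 z.1 _ _ (subset_tsupport ψ hz) ?_
          rw [dist_comm, dist_eq_norm]
          simpa using (Metric.mem_ball.1 h1).le
        simp [this]
  calc ∫ x, conv k h x * ψ x = ∫ x, ∫ t, k (x - t) * h t * ψ x := by
        simp_rw [conv_apply, integral_mul_const]
    _ = ∫ t, ∫ x, k (x - t) * h t * ψ x := integral_integral_swap hint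
    _ = ∫ t, conv k ψ t * h t := by
        congr 1; ext t
        rw [conv_apply, ← integral_mul_const]
        congr 1; ext x
        rw [← neg_sub t x, hk, f.normed_neg]
        ring

/-- A sequence of bump functions shrinking to the origin, with controlled shape. -/
def bump (j : ℕ) : ContDiffBump (0 : Plane) :=
  ⟨1 / (2 * (j + 1)), 1 / (j + 1), by positivity, by
    rw [one_div, one_div]
    exact inv_strictAnti₀ (by positivity) (by linarith [(Nat.cast_nonneg j : (0 : ℝ) ≤ j)])⟩

theorem bump_rOut_le_one (j : ℕ) : (bump j).rOut ≤ 1 := by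
  have : (0 : ℝ) ≤ j := Nat.cast_nonneg j
  change 1 / ((j : ℝ) + 1) ≤ 1
  rw [div_le_one (by positivity)]; linarith

theorem tendsto_bump_rOut : Tendsto (fun j => (bump j).rOut) atTop (𝓝 0) :=
  tendsto_one_div_add_atTop_nhds_zero_nat

/-- The standard mollifiers, an approximate identity. -/
abbrev moll (j : ℕ) : Plane → ℝ := (bump j).normed volume

theorem ae_tendsto_conv_moll {u : Plane → ℝ} (hu : LocallyIntegrable u volume) :
    ∀ᵐ x, Tendsto (fun j => conv (moll j) u x) atTop (𝓝 (u x)) := by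
  refine ContDiffBump.ae_convolution_tendsto_right_of_locallyIntegrable (K := 2) tendsto_bump_rOut
    (Eventually.of_forall fun j => le_of_eq ?_) hu
  change 1 / ((j : ℝ) + 1) = 2 * (1 / (2 * (j + 1)))
  field_simp

/-- Mollifications converge weakly against continuous compactly supported functions. -/
theorem tendsto_integral_conv_moll_mul {h ψ : Plane → ℝ}
    (hh : LocallyIntegrable h volume) (hψ : Continuous ψ) (hc : HasCompactSupport ψ) :
    Tendsto (fun j => ∫ x, conv (moll j) h x * ψ x) atTop (𝓝 (∫ x, h x * ψ x)) := by
  simp_rw [integral_conv_normed_mul _ hh hψ hc, mul_comm (h _) (ψ _)]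
  obtain ⟨C, hC⟩ := hc.exists_bound_of_continuous hψ
  set K : Set Plane := Metric.cthickening 1 (tsupport ψ) with hK
  have hKc : IsCompact K := hc.isCompact.cthickening
  refine tendsto_integral_of_dominated_convergence (fun t => C * K.indicator (fun t => |h t|) t)
    (fun j => ?_) ?_ (fun j => ae_of_all _ fun t => ?_) (ae_of_all _ fun t => ?_)
  · have := (contDiff_conv (isTestFunction_normed (bump j)) hψ.locallyIntegrable).continuous
    exact this.aestronglyMeasurable.mul hh.aestronglyMeasurable
  · exact ((integrable_indicator_iff hKc.isClosed.measurableSet).2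
      (hh.integrableOn_isCompact hKc).abs).const_mul C
  · rw [norm_mul, Real.norm_eq_abs, Real.norm_eq_abs]
    by_cases ht : t ∈ K
    · rw [Set.indicator_of_mem ht]
      exact mul_le_mul_of_nonneg_right (abs_conv_normed_le_of_bound _ hC t) (abs_nonneg _)
    · rw [Set.indicator_of_notMem ht]
      have : conv (moll j) ψ t = 0 := by
        rw [conv_apply]
        refine integral_eq_zero_of_ae (ae_of_all _ fun x => ?_)
        by_contra hne
        apply ht
        have h1 : t - x ∈ Metric.ball (0 : Plane) (bump j).rOut := by
          rw [← (bump j).support_normed_eq (μ := volume)]; exact left_ne_zero_of_mul hne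
        refine Metric.mem_cthickening_of_dist_le t x _ _
          (subset_tsupport ψ (right_ne_zero_of_mul hne)) ?_
        rw [dist_eq_norm]
        have := (Metric.mem_ball.1 h1).le
        rw [dist_zero_right] at this
        exact this.trans (bump_rOut_le_one j)
      simp [this]
  · exact (ContDiffBump.convolution_tendsto_right_of_continuous tendsto_bump_rOut hψ t).mul_const _

/-! ### Kato's inequality for distributional Laplacians and the comparison principle -/

/-- Fatou's lemma along a convergent sequence of upper bounds. -/
theorem integral_le_of_tendsto_of_integral_le {F : ℕ → Plane → ℝ} {f : Plane → ℝ} {B : ℕ → ℝ}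
    {b : ℝ} (hF0 : ∀ j x, 0 ≤ F j x) (hFi : ∀ j, Integrable (F j)) (hf : Integrable f)
    (hlim : ∀ᵐ x, Tendsto (fun j => F j x) atTop (𝓝 (f x))) (hFB : ∀ j, ∫ x, F j x ≤ B j)
    (hB : Tendsto B atTop (𝓝 b)) : ∫ x, f x ≤ b := by
  have hf0 : 0 ≤ᵐ[volume] f := by
    filter_upwards [hlim] with x hx using ge_of_tendsto' hx fun j => hF0 j x
  have hb : 0 ≤ b := ge_of_tendsto' hB fun j => (integral_nonneg (hF0 j)).trans (hFB j)
  rw [← ENNReal.ofReal_le_ofReal_iff hb, ofReal_integral_eq_lintegral_ofReal hf hf0]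
  calc ∫⁻ x, ENNReal.ofReal (f x)
      = ∫⁻ x, liminf (fun j => ENNReal.ofReal (F j x)) atTop := by
        refine lintegral_congr_ae ?_
        filter_upwards [hlim] with x hx
        exact ((ENNReal.continuous_ofReal.tendsto _).comp hx).liminf_eq.symm
    _ ≤ liminf (fun j => ∫⁻ x, ENNReal.ofReal (F j x)) atTop :=
        lintegral_liminf_le' fun j => (hFi j).aestronglyMeasurable.aemeasurable.ennreal_ofReal
    _ ≤ liminf (fun j => ENNReal.ofReal (B j)) atTop := by
        refine liminf_le_liminf (Eventually.of_forall fun j => ?_)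
        rw [← ofReal_integral_eq_lintegral_ofReal (hFi j) (ae_of_all _ (hF0 j))]
        exact ENNReal.ofReal_le_ofReal (hFB j)
    _ = ENNReal.ofReal b := ((ENNReal.continuous_ofReal.tendsto _).comp hB).liminf_eq

theorem locallyIntegrable_abs {g : Plane → ℝ} (hg : LocallyIntegrable g volume) :
    LocallyIntegrable (fun t => |g t|) volume := fun x =>
  (hg x).imp fun _ hs => ⟨hs.1, Integrable.abs hs.2⟩

/-- Kato's inequality for a distributional Laplacian `Δd = g` with `g` merely locally integrable. -/
theorem HasWeakLaplacian.kato_le {d g χ : Plane → ℝ} (h : HasWeakLaplacian d g)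
    (hχ : IsTestFunction χ) (hχ0 : ∀ x, 0 ≤ χ x) :
    ∫ x, g x * expNegInvGlue (d x) * χ x ≤ ∫ x, |d x| * |lap χ x| := by
  have hT : Continuous expNegInvGlue := (expNegInvGlue.contDiff (n := 0)).continuous
  have hga := locallyIntegrable_abs h.2.1
  have hda := locallyIntegrable_abs h.1
  have hlχ := isTestFunction_lap hχ
  have hlχc : Continuous fun x => |lap χ x| := hlχ.1.continuous.abs
  have hlχs : HasCompactSupport fun x => |lap χ x| := hlχ.2.comp_left abs_zero
  have hk := fun j => isTestFunction_normed (bump j)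
  have cD := fun j => contDiff_conv (hk j) h.1
  have cG := fun j => (contDiff_conv (hk j) h.2.1).continuous
  have cH := fun j => (contDiff_conv (hk j) hga).continuous
  have cA := fun j => (contDiff_conv (hk j) hda).continuous
  have hTb : ∀ (a s : ℝ), |a * expNegInvGlue s| ≤ |a| := fun a s => by
    rw [abs_mul, abs_of_nonneg (expNegInvGlue.nonneg s)]
    exact mul_le_of_le_one_right (abs_nonneg a) (expNegInvGlue_le_one s)
  have i1 : Integrable fun x => |g x| * χ x := by
    simpa only [mul_comm] using integrable_mul_of_locallyIntegrable hga hχ.1.continuous hχ.2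
  have i2 : Integrable fun x => g x * expNegInvGlue (d x) * χ x := by
    refine i1.mono' ((h.2.1.aestronglyMeasurable.mul
      (hT.comp_aestronglyMeasurable h.1.aestronglyMeasurable)).mul
        hχ.1.continuous.aestronglyMeasurable) (ae_of_all _ fun x => ?_)
    rw [norm_mul, Real.norm_of_nonneg (hχ0 x)]
    exact mul_le_mul_of_nonneg_right (hTb _ _) (hχ0 x)
  have j1 : ∀ j, Integrable fun x => conv (moll j) (fun t => |g t|) x * χ x := fun j =>
    ((cH j).mul hχ.1.continuous).integrable_of_hasCompactSupport hχ.2.mul_left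
  have j2 : ∀ j, Integrable fun x =>
      lap (conv (moll j) d) x * expNegInvGlue (conv (moll j) d x) * χ x := fun j => by
    simp_rw [h.lap_conv (hk j)]
    exact (((cG j).mul (hT.comp (cD j).continuous)).mul
      hχ.1.continuous).integrable_of_hasCompactSupport hχ.2.mul_left
  -- with `T = expNegInvGlue ≤ 1` and mollifiers `m`, the functions `(m ⋆ |g| + (m ⋆ g) T(m ⋆ d)) χ`
  -- are nonnegative, which makes Fatou's lemma applicable
  have key := integral_le_of_tendsto_of_integral_le
    (F := fun j x => conv (moll j) (fun t => |g t|) x * χ x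
      + lap (conv (moll j) d) x * expNegInvGlue (conv (moll j) d x) * χ x)
    (f := fun x => |g x| * χ x + g x * expNegInvGlue (d x) * χ x)
    (B := fun j => (∫ x, conv (moll j) (fun t => |g t|) x * χ x)
      + ∫ x, conv (moll j) (fun t => |d t|) x * |lap χ x|)
    (b := (∫ x, |g x| * χ x) + ∫ x, |d x| * |lap χ x|)
    (fun j x => ?_) (fun j => (j1 j).add (j2 j)) (i1.add i2) ?_ (fun j => ?_) ?_
  · rw [integral_add i1 i2] at key
    linarith
  · rw [h.lap_conv (hk j), ← add_mul]
    refine mul_nonneg ?_ (hχ0 x)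
    have h1 := abs_le.1 ((hTb (conv (moll j) g x) (conv (moll j) d x)).trans
      (abs_conv_normed_le (bump j) g x))
    linarith [h1.1]
  · filter_upwards [ae_tendsto_conv_moll h.1, ae_tendsto_conv_moll h.2.1,
      ae_tendsto_conv_moll hga] with x hx1 hx2 hx3
    simp_rw [h.lap_conv (hk _)]
    exact (hx3.mul_const _).add ((hx2.mul ((hT.tendsto _).comp hx1)).mul_const _)
  · rw [integral_add (j1 j) (j2 j)]
    have h1 := kato_smooth (cD j) hχ hχ0
    have h2 : ∫ x, kato (conv (moll j) d x) * lap χ x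
        ≤ ∫ x, conv (moll j) (fun t => |d t|) x * |lap χ x| := by
      refine integral_mono (((contDiff_kato.continuous.comp (cD j).continuous).mul
        hlχ.1.continuous).integrable_of_hasCompactSupport hlχ.2.mul_left)
        (((cA j).mul hlχc).integrable_of_hasCompactSupport hlχs.mul_left) fun x => ?_
      refine (le_abs_self _).trans ?_
      rw [abs_mul]
      exact mul_le_mul_of_nonneg_right ((abs_kato_le _).trans (abs_conv_normed_le _ _ _))
        (abs_nonneg _)
    linarith
  · exact (tendsto_integral_conv_moll_mul hga hχ.1.continuous hχ.2).add
      (tendsto_integral_conv_moll_mul hda hlχc hlχs)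

theorem fderiv_comp_smul_apply {k : Plane → ℝ} (hk : Differentiable ℝ k) (c : ℝ) (x v : Plane) :
    fderiv ℝ (fun x => k (c • x)) x v = c * fderiv ℝ k (c • x) v := by
  have := (hk (c • x)).hasFDerivAt.comp x ((hasFDerivAt_id x).const_smul c)
  rw [show (fun x => k (c • x)) = k ∘ HSMul.hSMul c from rfl, this.fderiv]
  simp

theorem lap_comp_smul {k : Plane → ℝ} (hk : IsTestFunction k) (c : ℝ) (x : Plane) :
    lap (fun x => k (c • x)) x = c ^ 2 * lap k (c • x) := by
  unfold lap
  rw [Finset.mul_sum]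
  refine Finset.sum_congr rfl fun i _ => ?_
  have h1 : (fun y => fderiv ℝ (fun x => k (c • x)) y (EuclideanSpace.single i 1))
      = fun y => c * fderiv ℝ k (c • y) (EuclideanSpace.single i 1) := by
    ext y; exact fderiv_comp_smul_apply (hk.1.differentiable (by simp)) c y _
  have h2 := (hk.fderiv_apply (EuclideanSpace.single i 1)).1.differentiable (by simp)
  have h3 : DifferentiableAt ℝ (fun y => fderiv ℝ k (c • y) (EuclideanSpace.single i 1)) x :=
    (h2 (c • x)).comp x (differentiableAt_id.const_smul c)
  rw [h1, fderiv_const_mul h3, smul_apply,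
    fderiv_comp_smul_apply h2, smul_eq_mul]
  ring

theorem IsTestFunction.comp_smul {k : Plane → ℝ} (hk : IsTestFunction k) {c : ℝ} (hc : c ≠ 0) :
    IsTestFunction (fun x => k (c • x)) :=
  ⟨hk.1.comp (contDiff_const_smul c), hk.2.comp_homeomorph (Homeomorph.smulOfNeZero c hc)⟩

/-- Comparison principle on the whole plane: a square integrable `d` whose distributional
Laplacian is positive wherever `d` is positive cannot be positive. -/
theorem HasWeakLaplacian.ae_nonpos {d g : Plane → ℝ} (h : HasWeakLaplacian d g)
    (hd : MemLp d 2 volume) (hpos : ∀ᵐ x, 0 < d x → 0 < g x) : ∀ᵐ x, d x ≤ 0 := by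
  have hT : Continuous expNegInvGlue := (expNegInvGlue.contDiff (n := 0)).continuous
  have hnn : ∀ᵐ x, 0 ≤ g x * expNegInvGlue (d x) := by
    filter_upwards [hpos] with x hx
    rcases le_or_gt (d x) 0 with h0 | h0
    · simp [expNegInvGlue.zero_of_nonpos h0]
    · exact mul_nonneg (hx h0).le (expNegInvGlue.nonneg _)
  have hli : LocallyIntegrable (fun x => g x * expNegInvGlue (d x)) volume := by
    refine h.2.1.mono (h.2.1.aestronglyMeasurable.mul
      (hT.comp_aestronglyMeasurable h.1.aestronglyMeasurable)) (ae_of_all _ fun x => ?_)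
    rw [norm_mul, Real.norm_of_nonneg (expNegInvGlue.nonneg (d x))]
    exact mul_le_of_le_one_right (norm_nonneg _) (expNegInvGlue_le_one _)
  let χ : ContDiffBump (0 : Plane) := ⟨1, 2, by norm_num, by norm_num⟩
  have hχ : IsTestFunction χ := ⟨χ.contDiff, χ.hasCompactSupport⟩
  set A := (∫ x, d x ^ 2) + ∫ x, lap χ x ^ 2 with hA
  have hlχ := isTestFunction_lap hχ
  have hlsq : Integrable fun x => lap χ x ^ 2 := by
    simp_rw [pow_two]
    exact (hlχ.1.continuous.mul hlχ.1.continuous).integrable_of_hasCompactSupport hlχ.2.mul_left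
  have bound : ∀ R : ℝ, 0 < R →
      ∫ x, g x * expNegInvGlue (d x) * χ (R⁻¹ • x) ≤ A / (2 * R) := by
    intro R hR
    refine (h.kato_le (hχ.comp_smul (inv_ne_zero hR.ne')) fun x => χ.nonneg).trans ?_
    have hi : Integrable fun x => (lap χ (R⁻¹ • x)) ^ 2 :=
      hlsq.comp_smul (inv_ne_zero hR.ne')
    have hsc : ∫ x, (lap χ (R⁻¹ • x)) ^ 2 = R ^ 2 * ∫ x, lap χ x ^ 2 := by
      rw [Measure.integral_comp_inv_smul volume (fun x => lap χ x ^ 2) R]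
      simp
    calc ∫ x, |d x| * |lap (fun x => χ (R⁻¹ • x)) x|
        ≤ ∫ x, (1 / (2 * R)) * (d x ^ 2 + (R⁻¹) ^ 2 * (lap χ (R⁻¹ • x)) ^ 2) := by
          refine integral_mono_of_nonneg (ae_of_all _ fun x => by positivity)
            ((hd.integrable_sq.add (hi.const_mul _)).const_mul _) (ae_of_all _ fun x => ?_)
          simp only
          rw [lap_comp_smul hχ, abs_mul, abs_of_nonneg (sq_nonneg R⁻¹)]
          -- the factors `R⁻¹` are split so that the scaled `L²` norm of `lap χ` does not depend on `R`
          have := sq_nonneg (|d x| - R⁻¹ * |lap χ (R⁻¹ • x)|)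
          have e : |d x| * ((R⁻¹) ^ 2 * |lap χ (R⁻¹ • x)|)
            = (1 / (2 * R)) * (2 * |d x| * (R⁻¹ * |lap χ (R⁻¹ • x)|)) := by
            field_simp
          rw [e]
          refine mul_le_mul_of_nonneg_left ?_ (by positivity)
          rw [← sq_abs (d x), ← sq_abs (lap χ _)]
          nlinarith
      _ = A / (2 * R) := by
          rw [integral_const_mul, integral_add hd.integrable_sq (hi.const_mul _),
            integral_const_mul, hsc, hA]
          field_simp
  have hball : ∀ N : ℕ, ∀ᵐ x ∂(volume.restrict (Metric.closedBall (0 : Plane) N)),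
      g x * expNegInvGlue (d x) = 0 := by
    intro N
    have hI := hli.integrableOn_isCompact (isCompact_closedBall (0 : Plane) N)
    have hle : ∀ᶠ R : ℝ in atTop, ∫ x in Metric.closedBall (0 : Plane) N,
        g x * expNegInvGlue (d x) ≤ A / (2 * R) := by
      filter_upwards [eventually_ge_atTop (N : ℝ), eventually_gt_atTop 0] with R hRN hR
      refine le_trans ?_ (bound R hR)
      rw [← integral_indicator measurableSet_closedBall]
      refine integral_mono_ae ((integrable_indicator_iff measurableSet_closedBall).2 hI) ?_ ?_
      · simpa only [mul_comm] using integrable_mul_of_locallyIntegrable hli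
          (hχ.comp_smul (inv_ne_zero hR.ne')).1.continuous (hχ.comp_smul (inv_ne_zero hR.ne')).2
      · filter_upwards [hnn] with x hx
        by_cases hxN : x ∈ Metric.closedBall (0 : Plane) N
        · rw [Set.indicator_of_mem hxN, χ.one_of_mem_closedBall, mul_one]
          rw [mem_closedBall_zero_iff] at hxN ⊢
          rw [norm_smul, Real.norm_of_nonneg (by positivity)]
          change R⁻¹ * ‖x‖ ≤ 1
          rw [inv_mul_le_iff₀ hR]; linarith
        · rw [Set.indicator_of_notMem hxN]
          exact mul_nonneg hx χ.nonneg
    have hlim : Tendsto (fun R : ℝ => A / (2 * R)) atTop (𝓝 0) :=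
      tendsto_const_nhds.div_atTop (tendsto_id.const_mul_atTop two_pos)
    have h0 := ge_of_tendsto hlim hle
    have hnn' := ae_restrict_of_ae (s := Metric.closedBall (0 : Plane) N) hnn
    exact (integral_eq_zero_iff_of_nonneg_ae hnn' hI).1
      (le_antisymm h0 (integral_nonneg_of_ae hnn'))
  have hall : ∀ᵐ x, ∀ N : ℕ, x ∈ Metric.closedBall (0 : Plane) N → g x * expNegInvGlue (d x) = 0 :=
    ae_all_iff.2 fun N => (ae_restrict_iff' measurableSet_closedBall).1 (hball N)
  filter_upwards [hall, hpos] with x hx hxp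
  by_contra! hc
  obtain ⟨N, hN⟩ := exists_nat_ge ‖x‖
  exact (mul_pos (hxp hc) (expNegInvGlue.pos_of_pos hc)).ne' (hx N (by simpa using hN))

theorem HasWeakLaplacian.sub {u v f g : Plane → ℝ} (hu : HasWeakLaplacian u f)
    (hv : HasWeakLaplacian v g) : HasWeakLaplacian (fun x => u x - v x) (fun x => f x - g x) := by
  refine ⟨hu.1.sub hv.1, hu.2.1.sub hv.2.1, fun φ hφ => ?_⟩
  have hl := isTestFunction_lap hφ
  have i := fun {w : Plane → ℝ} (hw : LocallyIntegrable w volume) {ψ : Plane → ℝ}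
    (hψ : IsTestFunction ψ) => integrable_mul_of_locallyIntegrable hw hψ.1.continuous hψ.2
  simp_rw [sub_mul, mul_comm _ (lap φ _), mul_comm _ (φ _)]
  rw [integral_sub (i hu.1 hl) (i hv.1 hl), integral_sub (i hu.2.1 hφ) (i hv.2.1 hφ)]
  simp_rw [mul_comm (lap φ _), mul_comm (φ _)]
  rw [hu.2.2 φ hφ, hv.2.2 φ hφ]

theorem HasWeakLaplacian.const_mul {u f : Plane → ℝ} (hu : HasWeakLaplacian u f) (c : ℝ) :
    HasWeakLaplacian (fun x => c * u x) (fun x => c * f x) := by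
  refine ⟨hu.1.smul c, hu.2.1.smul c, fun φ hφ => ?_⟩
  simp_rw [mul_assoc]
  rw [integral_const_mul, integral_const_mul, hu.2.2 φ hφ]

theorem hasWeakLaplacian_zero : HasWeakLaplacian (fun _ => 0) (fun _ => 0) :=
  ⟨locallyIntegrable_zero, locallyIntegrable_zero, fun φ _ => by simp⟩

/-- Comparison of two square integrable functions through their distributional Laplacians. -/
theorem HasWeakLaplacian.ae_le {u v f g : Plane → ℝ} (hu : HasWeakLaplacian u f)
    (hv : HasWeakLaplacian v g) (hu2 : MemLp u 2 volume) (hv2 : MemLp v 2 volume)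
    (h : ∀ᵐ x, v x < u x → g x < f x) : ∀ᵐ x, u x ≤ v x := by
  have := (hu.sub hv).ae_nonpos (hu2.sub hv2) (by
    filter_upwards [h] with x hx hlt
    exact sub_pos.2 (hx (sub_pos.1 hlt)))
  filter_upwards [this] with x hx using sub_nonpos.1 hx

theorem inner_gradient_eq_sum (φ : Plane → ℝ) (v x : Plane) :
    inner ℝ v (gradient φ x) = ∑ i : Fin 2, v i * fderiv ℝ φ x (EuclideanSpace.single i 1) := by
  have h1 : v = ∑ i : Fin 2, v i • EuclideanSpace.single i (1 : ℝ) := by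
    ext j; fin_cases j <;> simp [Fin.sum_univ_two]
  rw [real_inner_comm, gradient, InnerProductSpace.toDual_symm_apply]
  conv_lhs => rw [h1]
  rw [map_sum]
  exact Finset.sum_congr rfl fun i _ => by rw [map_smul, smul_eq_mul]

/-- A weak solution in the sense of weak gradients is a distributional solution. -/
theorem IsWeakSolution.hasWeakLaplacian {u F : Plane → ℝ} (h : IsWeakSolution u F) :
    HasWeakLaplacian u F := by
  obtain ⟨hF, G, ⟨hu, hG, hw⟩, hs⟩ := h
  refine ⟨hu, hF, fun φ hφ => ?_⟩
  have hGi : ∀ i, LocallyIntegrable (fun x => G x i) volume := fun i x =>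
    (hG x).imp fun s hs => ⟨hs.1, (EuclideanSpace.proj (𝕜 := ℝ) i).integrable_comp hs.2⟩
  have h2 := hs φ hφ
  simp_rw [inner_gradient_eq_sum] at h2
  have hdi := fun i : Fin 2 => hφ.fderiv_apply (EuclideanSpace.single i 1)
  rw [integral_finsetSum _ fun i _ => by
    simpa only [mul_comm] using integrable_mul_of_locallyIntegrable (hGi i)
      (hdi i).1.continuous (hdi i).2] at h2
  have h3 : ∀ i : Fin 2, ∫ x, G x i * fderiv ℝ φ x (EuclideanSpace.single i 1)
      = -∫ x, u x * fderiv ℝ (fun y => fderiv ℝ φ y (EuclideanSpace.single i 1)) x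
        (EuclideanSpace.single i 1) := fun i => by
    rw [hw _ (hdi i) i, neg_neg]
  simp_rw [h3] at h2
  rw [Finset.sum_neg_distrib, neg_inj] at h2
  rw [← h2, ← integral_finsetSum]
  · simp_rw [lap, Finset.mul_sum]
  · intro i _
    have := (hdi i).fderiv_apply (EuclideanSpace.single i 1)
    simpa only [mul_comm] using integrable_mul_of_locallyIntegrable hu this.1.continuous this.2

/-! ### The resolvent `(κ - Δ)⁻¹` on square integrable functions -/

/-- The Fourier symbol `1 / (κ + 4π²|ξ|²)` of `(κ - Δ)⁻¹`. -/
def symb (κ : ℝ) (ξ : Plane) : ℝ := (κ + (2 * Real.pi * ‖ξ‖) ^ 2)⁻¹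

theorem symb_pos {κ : ℝ} (hκ : 0 < κ) (ξ : Plane) : 0 < symb κ ξ := by
  unfold symb; positivity

theorem continuous_symb {κ : ℝ} (hκ : 0 < κ) : Continuous (symb κ) := by
  unfold symb
  exact Continuous.inv₀ (by fun_prop) fun ξ => by positivity

theorem symb_mul {κ : ℝ} (hκ : 0 < κ) (ξ : Plane) :
    (2 * Real.pi * ‖ξ‖) ^ 2 * symb κ ξ = 1 - κ * symb κ ξ := by
  have : κ + (2 * Real.pi * ‖ξ‖) ^ 2 ≠ 0 := by positivity
  unfold symb; field_simp; ring

theorem symb_le {κ : ℝ} (hκ : 0 < κ) (ξ : Plane) : symb κ ξ ≤ κ⁻¹ := by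
  unfold symb
  exact inv_anti₀ hκ (by nlinarith [sq_nonneg (2 * Real.pi * ‖ξ‖)])

theorem norm_mul_symb_le {κ : ℝ} (hκ : 0 < κ) (ξ : Plane) :
    2 * Real.pi * ‖ξ‖ * symb κ ξ ≤ 1 + κ⁻¹ := by
  have h1 := symb_mul hκ ξ
  have h2 := symb_le hκ ξ
  have h3 := (symb_pos hκ ξ).le
  have h4 : 2 * Real.pi * ‖ξ‖ ≤ 1 + (2 * Real.pi * ‖ξ‖) ^ 2 := by
    nlinarith [sq_nonneg (2 * Real.pi * ‖ξ‖ - 1)]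
  have := mul_le_mul_of_nonneg_right h4 h3
  nlinarith [mul_nonneg hκ.le h3]

theorem integrable_symb_sq {κ : ℝ} (hκ : 0 < κ) : Integrable fun ξ => symb κ ξ ^ 2 := by
  have h := (integrable_rpow_neg_one_add_norm_sq (E := Plane) (μ := volume) (r := 4)
    (by norm_num)).const_mul ((1 + κ⁻¹) ^ 2)
  refine h.mono' ((continuous_symb hκ).pow 2).aestronglyMeasurable (ae_of_all _ fun ξ => ?_)
  rw [Real.norm_of_nonneg (sq_nonneg _), show (-4 / 2 : ℝ) = ((-2 : ℤ) : ℝ) by norm_num,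
    Real.rpow_intCast, zpow_neg, ← inv_zpow, show (2 : ℤ) = ((2 : ℕ) : ℤ) by rfl, zpow_natCast,
    ← mul_pow]
  refine pow_le_pow_left₀ (symb_pos hκ ξ).le ?_ 2
  have h1 := symb_mul hκ ξ
  have h2 := symb_le hκ ξ
  have h3 := (symb_pos hκ ξ).le
  rw [← div_eq_mul_inv, le_div_iff₀ (by positivity)]
  have h5 : ‖ξ‖ ^ 2 ≤ (2 * Real.pi * ‖ξ‖) ^ 2 := by
    refine pow_le_pow_left₀ (norm_nonneg _) ?_ 2
    nlinarith [norm_nonneg ξ, Real.pi_gt_three]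
  nlinarith [mul_nonneg hκ.le h3, mul_le_mul_of_nonneg_right h5 h3]

theorem memLp_symb {κ : ℝ} (hκ : 0 < κ) : MemLp (symb κ) 2 volume :=
  (memLp_two_iff_integrable_sq (continuous_symb hκ).aestronglyMeasurable).2
    (integrable_symb_sq hκ)

/-- The norm of `(κ - Δ)⁻¹ : L² → L^∞`, namely the `L²` norm of the symbol. -/
def supBound (κ : ℝ) : ℝ := (eLpNorm (symb κ) 2 volume).toReal

theorem supBound_nonneg (κ : ℝ) : 0 ≤ supBound κ := ENNReal.toReal_nonneg

theorem supBound_eq {κ : ℝ} (hκ : 0 < κ) : supBound κ = √(∫ ξ, symb κ ξ ^ 2) := by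
  rw [supBound, (memLp_symb hκ).eLpNorm_eq_integral_rpow_norm (by norm_num) (by norm_num),
    ENNReal.toReal_ofReal (by positivity), Real.sqrt_eq_rpow]
  norm_num

/-- In dimension two the `L² → L^∞` norm of `κ(κ - Δ)⁻¹` tends to `0` with `κ`. -/
theorem tendsto_mul_supBound : Tendsto (fun κ => κ * supBound κ) (𝓝[>] 0) (𝓝 0) := by
  have h1 : Tendsto (fun κ => ∫ ξ, (κ * symb κ ξ) ^ 2) (𝓝[>] 0) (𝓝 (∫ _ : Plane, (0 : ℝ))) := by
    refine tendsto_integral_filter_of_dominated_convergence (fun ξ => symb 1 ξ ^ 2) ?_ ?_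
      (integrable_symb_sq one_pos) ?_
    · filter_upwards [self_mem_nhdsWithin] with κ hκ
      exact ((continuous_const.mul (continuous_symb hκ)).pow 2).aestronglyMeasurable
    · filter_upwards [self_mem_nhdsWithin, mem_nhdsWithin_of_mem_nhds (Iio_mem_nhds one_pos)]
        with κ hκ hκ1
      refine ae_of_all _ fun ξ => ?_
      rw [Real.norm_of_nonneg (sq_nonneg _)]
      have hκ0 : 0 < κ := hκ
      refine pow_le_pow_left₀ (mul_nonneg hκ0.le (symb_pos hκ ξ).le) ?_ 2
      unfold symb
      have hκ1' : κ < 1 := hκ1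
      rw [← div_eq_mul_inv, ← one_div, div_le_div_iff₀ (by positivity) (by positivity)]
      nlinarith [sq_nonneg (2 * Real.pi * ‖ξ‖)]
    · have h0 : ∀ᵐ ξ : Plane, ξ ≠ 0 := by
        simp [ae_iff]
      filter_upwards [h0] with ξ hξ
      have hc : ContinuousAt (fun κ : ℝ => (κ * symb κ ξ) ^ 2) 0 := by
        unfold symb
        have : (0 : ℝ) + (2 * Real.pi * ‖ξ‖) ^ 2 ≠ 0 := by
          have := norm_pos_iff.2 hξ
          positivity
        fun_prop (disch := assumption)
      have := hc.tendsto
      simp only [zero_mul, ne_eq, OfNat.ofNat_ne_zero, not_false_eq_true, zero_pow] at this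
      exact this.mono_left nhdsWithin_le_nhds
  rw [integral_zero] at h1
  have h2 := h1.sqrt
  rw [Real.sqrt_zero] at h2
  refine h2.congr' ?_
  filter_upwards [self_mem_nhdsWithin] with κ hκ
  have hκ0 : 0 < κ := hκ
  simp_rw [mul_pow]
  rw [integral_const_mul, Real.sqrt_mul (sq_nonneg _), Real.sqrt_sq hκ0.le, supBound_eq hκ]

/-- Parseval's formula for an `L²` function and a Schwartz function. -/
theorem integral_smul_fourierInv_Lp (W : Lp ℂ 2 (volume : Measure Plane)) (ψ : 𝓢(Plane, ℂ)) :
    ∫ x, ψ x * (𝓕⁻ W : Lp ℂ 2 (volume : Measure Plane)) x = ∫ ξ, (𝓕⁻ ψ) ξ * W ξ := by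
  have h := congrArg (fun T => T ψ) (Lp.fourierInv_toTemperedDistribution_eq W)
  simp only [TemperedDistribution.fourierInv_apply, Lp.toTemperedDistribution_apply,
    smul_eq_mul] at h
  exact h.symm

/-- Parseval's formula for an integrable function and a Schwartz function. -/
theorem integral_mul_fourierInv {a : Plane → ℂ} (ha : Integrable a) (ψ : 𝓢(Plane, ℂ)) :
    ∫ x, ψ x * 𝓕⁻ a x = ∫ ξ, (𝓕⁻ ψ) ξ * a ξ := by
  have h1 : Integrable fun x => ψ (-x) := ψ.integrable.comp_neg
  have h2 := VectorFourier.integral_fourierIntegral_smul_eq_flip (L := innerₗ Plane)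
      Real.continuous_fourierChar continuous_inner h1 ha
  rw [SchwartzMap.fourierInv_coe, Real.fourierInv_eq_fourier_comp_neg (ψ : Plane → ℂ)]
  simp_rw [Real.fourierInv_eq_fourier_neg]
  rw [← integral_neg_eq_self (fun x => ψ x * 𝓕 a (-x))]
  simp only [neg_neg]
  simpa using! h2.symm

/-- A real test function, regarded as a complex Schwartz function. -/
def IsTestFunction.schwartz {φ : Plane → ℝ} (h : IsTestFunction φ) : 𝓢(Plane, ℂ) :=
  HasCompactSupport.toSchwartzMap (f := fun x => (φ x : ℂ)) (h.2.comp_left Complex.ofReal_zero)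
    (Complex.ofRealCLM.contDiff.comp h.1)

theorem IsTestFunction.schwartz_apply {φ : Plane → ℝ} (h : IsTestFunction φ) (x : Plane) :
    h.schwartz x = φ x := rfl

theorem IsTestFunction.fourierInv_schwartz_fderiv {φ : Plane → ℝ} (h : IsTestFunction φ)
    (i : Fin 2) (ξ : Plane) :
    (𝓕⁻ (h.fderiv_apply (EuclideanSpace.single i 1)).schwartz) ξ
      = -(2 * Real.pi * Complex.I * ξ i) * (𝓕⁻ h.schwartz) ξ := by
  have h1 : (h.fderiv_apply (EuclideanSpace.single i 1)).schwartz
      = ∂_{(EuclideanSpace.single i 1 : Plane)} h.schwartz := by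
    ext x
    rw [SchwartzMap.lineDerivOp_apply_eq_fderiv, IsTestFunction.schwartz_apply]
    have := Complex.ofRealCLM.hasFDerivAt.comp x (h.1.differentiable (by simp) x).hasFDerivAt
    rw [show (h.schwartz : Plane → ℂ) = Complex.ofRealCLM ∘ φ from rfl, this.fderiv]
    simp
  have h2 : (inner ℝ · (EuclideanSpace.single i 1 : Plane)).HasTemperateGrowth := by fun_prop
  rw [h1, SchwartzMap.fourierInv_lineDerivOp_eq]
  simp only [smul_apply, SchwartzMap.smulLeftCLM_apply_apply h2]
  simp [EuclideanSpace.inner_single_right]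
  ring

/-- The real part of the inverse Fourier transform of a square integrable function. -/
def reFourierInv {W : Plane → ℂ} (hW : MemLp W 2 volume) : Plane → ℝ :=
  fun x => ((𝓕⁻ (hW.toLp W) : Lp ℂ 2 (volume : Measure Plane)) x).re

theorem memLp_reFourierInv {W : Plane → ℂ} (hW : MemLp W 2 volume) :
    MemLp (reFourierInv hW) 2 volume :=
  MemLp.re (𝕜 := ℂ) (Lp.memLp (𝓕⁻ (hW.toLp W) : Lp ℂ 2 (volume : Measure Plane)))

theorem integral_reFourierInv_mul {W : Plane → ℂ} (hW : MemLp W 2 volume) {φ : Plane → ℝ}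
    (hφ : IsTestFunction φ) :
    ∫ x, reFourierInv hW x * φ x = (∫ ξ, (𝓕⁻ hφ.schwartz) ξ * W ξ).re := by
  have h1 := integral_smul_fourierInv_Lp (hW.toLp W) hφ.schwartz
  have h2 : ∫ ξ, (𝓕⁻ hφ.schwartz) ξ * (hW.toLp W) ξ = ∫ ξ, (𝓕⁻ hφ.schwartz) ξ * W ξ :=
    integral_congr_ae (hW.coeFn_toLp.mono fun ξ hξ => by simp only [hξ])
  have h3 : Integrable fun x =>
      hφ.schwartz x * (𝓕⁻ (hW.toLp W) : Lp ℂ 2 (volume : Measure Plane)) x :=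
    (hφ.schwartz.memLp 2 volume).integrable_mul (Lp.memLp _)
  rw [← h2, ← h1, ← RCLike.re_eq_complex_re, ← integral_re h3]
  congr 1; ext x
  rw [hφ.schwartz_apply, RCLike.re_eq_complex_re, Complex.re_ofReal_mul, mul_comm]; rfl

theorem memLp_mul_of_norm_le {H : Plane → ℂ} (hH : MemLp H 2 volume) {m : Plane → ℂ} {C : ℝ}
    (hm : Continuous m) (hC : ∀ ξ, ‖m ξ‖ ≤ C) : MemLp (fun ξ => m ξ * H ξ) 2 volume :=
  hH.of_le_mul (hm.aestronglyMeasurable.mul hH.aestronglyMeasurable) (ae_of_all _ fun ξ => by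
    rw [norm_mul]; exact mul_le_mul_of_nonneg_right (hC ξ) (norm_nonneg _))

/-- Solvability of `(κ - Δ)u = ρ` for square integrable `ρ`. Since the symbol is square integrable
in dimension two, the Fourier transform of the solution is integrable, and so the solution is
continuous and vanishes at infinity. -/
theorem exists_resolvent {κ : ℝ} (hκ : 0 < κ) {ρ : Plane → ℝ} (hρ : MemLp ρ 2 volume) :
    ∃ u : Plane → ℝ, Continuous u ∧ Tendsto u (cocompact Plane) (𝓝 0) ∧ MemLp u 2 volume ∧
      MemW12 u ∧ IsWeakSolution u (fun x => κ * u x - ρ x) ∧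
      ∀ x, |u x| ≤ supBound κ * (eLpNorm ρ 2 volume).toReal := by
  have hF : MemLp (fun x => (ρ x : ℂ)) 2 volume := hρ.ofReal
  set H : Lp ℂ 2 (volume : Measure Plane) := 𝓕 (hF.toLp _) with hH
  have hHm : MemLp H 2 volume := Lp.memLp H
  have hHF : ∀ {φ : Plane → ℝ} (hφ : IsTestFunction φ),
      ∫ x, ρ x * φ x = (∫ ξ, (𝓕⁻ hφ.schwartz) ξ * H ξ).re := by
    intro φ hφ
    rw [← integral_reFourierInv_mul hHm hφ]
    refine integral_congr_ae ?_
    have e : (𝓕⁻ (hHm.toLp H) : Lp ℂ 2 (volume : Measure Plane)) = hF.toLp _ := by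
      rw [Lp.toLp_coeFn, hH, fourierInv_fourier_eq]
    filter_upwards [hF.coeFn_toLp] with x hx
    simp only [reFourierInv]
    rw [e, hx, Complex.ofReal_re]
  -- the Fourier transforms of the solution and of its partial derivatives
  have ha : MemLp (fun ξ => (symb κ ξ : ℂ) * H ξ) 2 volume :=
    memLp_mul_of_norm_le hHm (Complex.continuous_ofReal.comp (continuous_symb hκ))
      (C := κ⁻¹) fun ξ => by
        rw [Complex.norm_real, Real.norm_of_nonneg (symb_pos hκ ξ).le]; exact symb_le hκ ξ
  have hb : ∀ i : Fin 2, MemLp (fun ξ : Plane =>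
      (2 * Real.pi * Complex.I * ξ i * symb κ ξ : ℂ) * H ξ) 2 volume := fun i =>
    memLp_mul_of_norm_le hHm (by
      have := Complex.continuous_ofReal.comp (continuous_symb hκ)
      have h2 : Continuous fun ξ : Plane => ((ξ i : ℝ) : ℂ) := by fun_prop
      exact (continuous_const.mul h2).mul this) (C := 1 + κ⁻¹) fun ξ => by
        refine le_trans ?_ (norm_mul_symb_le hκ ξ)
        simp only [norm_mul, Complex.norm_real, Complex.norm_I, Complex.norm_ofNat, mul_one]
        rw [Real.norm_of_nonneg (symb_pos hκ ξ).le, Real.norm_of_nonneg Real.pi_pos.le]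
        have : ‖ξ i‖ ≤ ‖ξ‖ := PiLp.norm_apply_le ξ i
        have h3 := (symb_pos hκ ξ).le
        gcongr
  have hai : Integrable fun ξ => (symb κ ξ : ℂ) * H ξ :=
    (memLp_symb hκ).ofReal.integrable_mul hHm
  set a : Plane → ℂ := fun ξ => (symb κ ξ : ℂ) * H ξ with ha_def
  have hci : Continuous (𝓕⁻ a) := by
    have : Continuous (𝓕 a) :=
      VectorFourier.fourierIntegral_continuous Real.continuous_fourierChar
        (continuous_inner : Continuous fun p : Plane × Plane => inner ℝ p.1 p.2) hai
    rw [show 𝓕⁻ a = fun x => 𝓕 a (-x) from funext fun x => Real.fourierInv_eq_fourier_neg a x]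
    exact this.comp continuous_neg
  have hlim : Tendsto (𝓕⁻ a) (cocompact Plane) (𝓝 0) := by
    rw [show 𝓕⁻ a = fun x => 𝓕 a (-x) from funext fun x => Real.fourierInv_eq_fourier_neg a x]
    exact (tendsto_integral_exp_inner_smul_cocompact a).comp
      (Homeomorph.neg Plane).isClosedEmbedding.tendsto_cocompact
  set u : Plane → ℝ := fun x => (𝓕⁻ a x).re with hu_def
  have hcu : Continuous u := Complex.continuous_re.comp hci
  have huU : u =ᵐ[volume] reFourierInv ha := by
    refine ae_eq_of_integral_contDiff_smul_eq hcu.locallyIntegrable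
      ((memLp_reFourierInv ha).locallyIntegrable (by norm_num)) fun φ h1 h2 => ?_
    have hφ : IsTestFunction φ := ⟨h1, h2⟩
    simp_rw [smul_eq_mul, mul_comm (φ _)]
    rw [integral_reFourierInv_mul ha hφ, ← integral_mul_fourierInv hai]
    have h3 : Integrable fun x => hφ.schwartz x * 𝓕⁻ a x :=
      (hφ.schwartz.continuous.mul hci).integrable_of_hasCompactSupport
        (HasCompactSupport.mul_right (h2.comp_left Complex.ofReal_zero))
    rw [← RCLike.re_eq_complex_re, ← integral_re h3]
    congr 1; ext x
    rw [hφ.schwartz_apply, RCLike.re_eq_complex_re, Complex.re_ofReal_mul, mul_comm]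
  have hu2 : MemLp u 2 volume := (memLp_reFourierInv ha).ae_eq huU.symm
  have hupair : ∀ {φ : Plane → ℝ} (hφ : IsTestFunction φ),
      ∫ x, u x * φ x = (∫ ξ, (𝓕⁻ hφ.schwartz) ξ * a ξ).re := by
    intro φ hφ
    rw [← integral_reFourierInv_mul ha hφ]
    exact integral_congr_ae (huU.mono fun x hx => by simp only [hx])
  -- the weak gradient
  set G : Plane → Plane := fun x => WithLp.toLp 2 fun i => reFourierInv (hb i) x with hG_def
  have hG : MemLp G 2 volume := memLp_piLp_iff.2 fun i => memLp_reFourierInv (hb i)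
  have hwg : HasWeakGradient u G := by
    refine ⟨hcu.locallyIntegrable, hG.locallyIntegrable (by norm_num), fun φ hφ i => ?_⟩
    rw [hupair (hφ.fderiv_apply _)]
    simp only [hG_def]
    rw [integral_reFourierInv_mul (hb i) hφ, ← Complex.neg_re, ← integral_neg]
    congr 2; ext ξ
    rw [hφ.fourierInv_schwartz_fderiv, ha_def]
    ring
  have hκρ : LocallyIntegrable (fun x => κ * u x - ρ x) volume :=
    (hcu.locallyIntegrable.smul κ).sub (hρ.locallyIntegrable (by norm_num))
  have hpre := fun {φ : Plane → ℝ} (hφ : IsTestFunction φ) =>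
    ((𝓕⁻ hφ.schwartz).memLp 2 (volume : Measure Plane))
  refine ⟨u, hcu, ?_, hu2, ⟨hu2, G, hwg, hG⟩, ⟨hκρ, G, hwg, fun φ hφ => ?_⟩, fun x => ?_⟩
  · have := (Complex.continuous_re.tendsto 0).comp hlim
    rw [Complex.zero_re] at this
    exact this
  · simp_rw [inner_gradient_eq_sum]
    simp only [hG_def]
    have i1 : Integrable fun ξ => (𝓕⁻ hφ.schwartz) ξ * a ξ := (hpre hφ).integrable_mul ha
    have i2 : Integrable fun ξ => (𝓕⁻ hφ.schwartz) ξ * H ξ := (hpre hφ).integrable_mul hHm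
    have i3 : Integrable fun x => u x * φ x := by
      simpa only [mul_comm] using
        integrable_mul_of_locallyIntegrable hcu.locallyIntegrable hφ.1.continuous hφ.2
    have i4 : Integrable fun x => ρ x * φ x := by
      simpa only [mul_comm] using integrable_mul_of_locallyIntegrable
        (hρ.locallyIntegrable (by norm_num)) hφ.1.continuous hφ.2
    have i5 : ∀ i ∈ (Finset.univ : Finset (Fin 2)), Integrable fun x =>
        reFourierInv (hb i) x * fderiv ℝ φ x (EuclideanSpace.single i 1) := fun i _ => by
      simpa only [mul_comm] using integrable_mul_of_locallyIntegrable
        ((memLp_reFourierInv (hb i)).locallyIntegrable (by norm_num))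
        (hφ.fderiv_apply _).1.continuous (hφ.fderiv_apply _).2
    have i6 : ∀ i : Fin 2, Integrable fun ξ =>
        (𝓕⁻ (hφ.fderiv_apply (EuclideanSpace.single i 1)).schwartz) ξ
          * ((2 * Real.pi * Complex.I * ξ i * symb κ ξ : ℂ) * H ξ) := fun i =>
      (hpre (hφ.fderiv_apply _)).integrable_mul (hb i)
    rw [integral_finsetSum _ i5]
    simp_rw [integral_reFourierInv_mul (hb _) (hφ.fderiv_apply _)]
    simp_rw [sub_mul, mul_assoc]
    rw [integral_sub (i3.const_mul κ) i4, integral_const_mul, hupair hφ, hHF hφ,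
      ← Complex.re_ofReal_mul, ← Complex.sub_re, ← Complex.neg_re, ← integral_const_mul,
      ← integral_sub (i1.const_mul _) i2, ← integral_neg, ← Complex.re_sum,
      ← integral_finsetSum _ fun i _ => by simpa only [mul_assoc] using i6 i]
    congr 2; ext ξ
    simp_rw [hφ.fourierInv_schwartz_fderiv]
    rw [Fin.sum_univ_two, ha_def]
    have hs := symb_mul hκ ξ
    rw [mul_pow, EuclideanSpace.norm_sq_eq, Fin.sum_univ_two] at hs
    simp only [Real.norm_eq_abs, sq_abs] at hs
    have hs' : (((2 * Real.pi) ^ 2 * (ξ 0 ^ 2 + ξ 1 ^ 2) * symb κ ξ : ℝ) : ℂ)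
        = ((1 - κ * symb κ ξ : ℝ) : ℂ) := by rw [hs]
    push_cast at hs'
    have hI := Complex.I_sq
    linear_combination ((𝓕⁻ hφ.schwartz) ξ * H ξ) * hs'
      - ((2 * Real.pi) ^ 2 * (ξ 0 ^ 2 + ξ 1 ^ 2) * symb κ ξ * (𝓕⁻ hφ.schwartz) ξ * H ξ) * hI
  · calc |u x| ≤ ‖𝓕⁻ a x‖ := Complex.abs_re_le_norm _
      _ ≤ ∫ ξ, ‖a ξ‖ := by
          rw [Real.fourierInv_eq]
          refine (norm_integral_le_integral_norm _).trans_eq ?_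
          simp_rw [Circle.norm_smul]
      _ = (eLpNorm a 1 volume).toReal := by
          rw [eLpNorm_one_eq_lintegral_enorm, integral_norm_eq_lintegral_enorm
            hai.aestronglyMeasurable]
      _ ≤ (eLpNorm (symb κ) 2 volume * eLpNorm H 2 volume).toReal := by
          refine ENNReal.toReal_mono (ENNReal.mul_ne_top (memLp_symb hκ).2.ne hHm.2.ne) ?_
          have := eLpNorm_smul_le_mul_eLpNorm (p := 2) (q := 2) (r := 1) hHm.aestronglyMeasurable
            (memLp_symb hκ).aestronglyMeasurable
          refine le_trans (le_of_eq ?_) this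
          refine eLpNorm_congr_ae (ae_of_all _ fun ξ => ?_)
          simp [ha_def]
      _ = supBound κ * (eLpNorm ρ 2 volume).toReal := by
          rw [ENNReal.toReal_mul, supBound, ← Lp.norm_def, hH, Lp.norm_fourier_eq, Lp.norm_toLp]
          congr 2
          refine eLpNorm_congr_norm_ae (ae_of_all _ fun x => by simp)

/-! ### Barriers -/

theorem le_of_ae_le {u v : Plane → ℝ} (hu : Continuous u) (hv : Continuous v)
    (h : ∀ᵐ x, u x ≤ v x) (x : Plane) : u x ≤ v x := by
  have h1 : IsClosed {x | u x ≤ v x} := isClosed_le hu hv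
  have h2 := (Measure.dense_of_ae h).closure_eq
  rw [h1.closure_eq] at h2
  have h3 : x ∈ {x | u x ≤ v x} := by rw [h2]; exact Set.mem_univ x
  exact h3

/-- A barrier: `y = (ε - Δ)⁻¹(q + s 1_B) ≥ 0` with `εy ≤ s` everywhere, for suitable small `ε` and
`s`. Adding `s 1_B` to the source compensates for the loss of coercivity of the potential on the
set `B`; it is affordable since `ε(ε - Δ)⁻¹ 1_B` is uniformly small. -/
theorem exists_barrier {q : Plane → ℝ} (hq : MemLp q 2 volume) (hq0 : ∀ x, 0 ≤ q x) {B : Set Plane}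
    (hB : MemLp (B.indicator (fun _ => (1 : ℝ))) 2 volume) :
    ∃ (ε s : ℝ) (y : Plane → ℝ), 0 < ε ∧ ε + s ≤ 1 / 2 ∧ Continuous y ∧ MemLp y 2 volume ∧
      (∀ x, 0 ≤ y x) ∧ (∀ x, ε * y x ≤ s) ∧
      HasWeakLaplacian y (fun x => ε * y x - (q x + s * B.indicator (fun _ => (1 : ℝ)) x)) := by
  set nq := (eLpNorm q 2 volume).toReal
  set nB := (eLpNorm (B.indicator (fun _ => (1 : ℝ))) 2 volume).toReal
  have hnq : 0 ≤ nq := ENNReal.toReal_nonneg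
  have h1 : Tendsto (fun ε => ε + 2 * (ε * supBound ε * nq)) (𝓝[>] 0) (𝓝 (0 + 2 * (0 * nq))) :=
    (tendsto_nhdsWithin_of_tendsto_nhds tendsto_id).add
      ((tendsto_mul_supBound.mul_const nq).const_mul 2)
  have h2 : Tendsto (fun ε => ε * supBound ε * nB) (𝓝[>] 0) (𝓝 (0 * nB)) :=
    tendsto_mul_supBound.mul_const nB
  obtain ⟨ε, h1ε, h2ε, hε⟩ := ((h1.eventually_le_const (u := 1 / 2) (by norm_num)).and
    ((h2.eventually_le_const (u := 1 / 2) (by norm_num)).and self_mem_nhdsWithin)).exists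
  have hε : 0 < ε := hε
  -- `εy` is at most `ε · supBound ε · nq + s · (ε · supBound ε · nB) ≤ s / 2 + s / 2`
  set s := 2 * (ε * supBound ε * nq) with hs
  have hs0 : 0 ≤ s := by have := supBound_nonneg ε; positivity
  have hρ : MemLp (fun x => q x + s * B.indicator (fun _ => (1 : ℝ)) x) 2 volume :=
    hq.add (hB.const_mul s)
  obtain ⟨y, hyc, -, hy2, -, hyw, hyb⟩ := exists_resolvent hε hρ
  have hyL := hyw.hasWeakLaplacian
  have hρ0 : ∀ x, 0 ≤ q x + s * B.indicator (fun _ => (1 : ℝ)) x := fun x =>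
    add_nonneg (hq0 x) (mul_nonneg hs0 (Set.indicator_nonneg (fun _ _ => zero_le_one) x))
  refine ⟨ε, s, y, hε, h1ε, hyc, hy2, fun x => ?_, fun x => ?_, hyL⟩
  · refine le_of_ae_le continuous_const hyc (hasWeakLaplacian_zero.ae_le hyL MemLp.zero' hy2
      (ae_of_all _ fun x hx => ?_)) x
    have := mul_neg_of_pos_of_neg hε hx
    linarith [hρ0 x]
  · have hn : (eLpNorm (fun x => q x + s * B.indicator (fun _ => (1 : ℝ)) x) 2 volume).toReal
        ≤ nq + s * nB := by
      have e : (eLpNorm (fun x => s * B.indicator (fun _ => (1 : ℝ)) x) 2 volume).toReal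
          = s * nB := by
        have := eLpNorm_const_smul s (B.indicator (fun _ => (1 : ℝ))) 2 (volume : Measure Plane)
        rw [show (fun x => s * B.indicator (fun _ => (1 : ℝ)) x)
          = s • (B.indicator (fun _ => (1 : ℝ))) from rfl, this, ENNReal.toReal_mul,
          toReal_enorm, Real.norm_of_nonneg hs0]
      rw [← e, ← ENNReal.toReal_add hq.2.ne (hB.const_mul s).2.ne]
      exact ENNReal.toReal_mono (ENNReal.add_ne_top.2 ⟨hq.2.ne, (hB.const_mul s).2.ne⟩)
        (eLpNorm_add_le hq.1 (hB.const_mul s).1 (by norm_num))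
    have h3 : y x ≤ supBound ε * (nq + s * nB) :=
      (le_abs_self _).trans ((hyb x).trans (mul_le_mul_of_nonneg_left hn (supBound_nonneg ε)))
    have h4 := mul_le_mul_of_nonneg_left h3 hε.le
    have h5 := mul_le_mul_of_nonneg_left h2ε hs0
    calc ε * y x ≤ ε * (supBound ε * (nq + s * nB)) := h4
      _ = ε * supBound ε * nq + s * (ε * supBound ε * nB) := by ring
      _ ≤ s / 2 + s * (1 / 2) := by rw [hs] at h5 ⊢; linarith
      _ = s := by ring

/-! ### Monotone iteration -/

theorem exp_sub_exp_le {a b M : ℝ} (hab : a ≤ b) (hb : b ≤ M) :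
    Real.exp b - Real.exp a ≤ Real.exp M * (b - a) := by
  have h1 : Real.exp b - Real.exp a = Real.exp b * (1 - Real.exp (a - b)) := by
    rw [mul_sub, ← Real.exp_add]; ring_nf
  rw [h1]
  have h2 := Real.add_one_le_exp (a - b)
  calc Real.exp b * (1 - Real.exp (a - b)) ≤ Real.exp b * (b - a) :=
        mul_le_mul_of_nonneg_left (by linarith) (Real.exp_pos b).le
    _ ≤ Real.exp M * (b - a) :=
        mul_le_mul_of_nonneg_right (Real.exp_le_exp.2 hb) (by linarith)

theorem abs_exp_sub_one_le {a M : ℝ} (hM : 0 ≤ M) (ha : a ≤ M) :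
    |Real.exp a - 1| ≤ Real.exp M * |a| := by
  rcases le_total 0 a with h | h
  · have := exp_sub_exp_le h ha
    rw [Real.exp_zero, sub_zero] at this
    rwa [abs_of_nonneg (sub_nonneg.2 (Real.one_le_exp h)), abs_of_nonneg h]
  · have := exp_sub_exp_le h hM
    rw [Real.exp_zero, zero_sub] at this
    rwa [abs_of_nonpos (sub_nonpos.2 (Real.exp_le_one_iff.2 h)), abs_of_nonpos h, neg_sub]

theorem abs_sub_sub_le {κ a c t r b : ℝ} (hκ : 0 ≤ κ) (ha : |a| ≤ b) (hc : |c| ≤ b)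
    (ht : |t| ≤ κ * b) : |κ * a - (κ * c - (t - r))| ≤ 3 * κ * b + |r| := by
  have h1 : |κ * a| ≤ κ * b := by
    rw [abs_mul, abs_of_nonneg hκ]; exact mul_le_mul_of_nonneg_left ha hκ
  have h2 : |κ * c| ≤ κ * b := by
    rw [abs_mul, abs_of_nonneg hκ]; exact mul_le_mul_of_nonneg_left hc hκ
  have h3 := abs_sub (κ * a) (κ * c - (t - r))
  have h4 := abs_sub (κ * c) (t - r)
  have h5 := abs_sub t r
  linarith

theorem IsWeakSolution.congr {u F F' : Plane → ℝ} (h : IsWeakSolution u F)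
    (hF : F =ᵐ[volume] F') : IsWeakSolution u F' := by
  obtain ⟨h1, G, h2, h3⟩ := h
  refine ⟨h1.congr hF, G, h2, fun φ hφ => ?_⟩
  rw [h3 φ hφ]
  congr 1
  exact integral_congr_ae (hF.mono fun x hx => by simp only [hx])

/-- Distributional Laplacians pass to dominated pointwise limits. -/
theorem hasWeakLaplacian_of_tendsto {v f : ℕ → Plane → ℝ} {z g b c : Plane → ℝ}
    (h : ∀ k, HasWeakLaplacian (v k) (f k)) (hb : LocallyIntegrable b volume)
    (hc : LocallyIntegrable c volume) (hvb : ∀ k x, |v k x| ≤ b x) (hfc : ∀ k x, |f k x| ≤ c x)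
    (hv : ∀ x, Tendsto (fun k => v k x) atTop (𝓝 (z x)))
    (hf : ∀ x, Tendsto (fun k => f k x) atTop (𝓝 (g x))) : HasWeakLaplacian z g := by
  have key : ∀ {v : ℕ → Plane → ℝ} {z b : Plane → ℝ}, (∀ k, LocallyIntegrable (v k) volume) →
      LocallyIntegrable b volume → (∀ k x, |v k x| ≤ b x) →
      (∀ x, Tendsto (fun k => v k x) atTop (𝓝 (z x))) → LocallyIntegrable z volume ∧
      ∀ ψ, IsTestFunction ψ →
        Tendsto (fun k => ∫ x, v k x * ψ x) atTop (𝓝 (∫ x, z x * ψ x)) := by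
    intro v z b hm hb hvb hv
    refine ⟨hb.mono (aestronglyMeasurable_of_tendsto_ae atTop
      (fun k => (hm k).aestronglyMeasurable) (ae_of_all _ hv)) (ae_of_all _ fun x =>
        (le_of_tendsto' (hv x).abs fun k => hvb k x).trans (le_abs_self _)), fun ψ hψ => ?_⟩
    refine tendsto_integral_of_dominated_convergence (fun x => |ψ x| * b x)
      (fun k => (hm k).aestronglyMeasurable.mul hψ.1.continuous.aestronglyMeasurable)
      (integrable_mul_of_locallyIntegrable hb hψ.1.continuous.abs (hψ.2.comp_left abs_zero))
      (fun k => ae_of_all _ fun x => ?_) (ae_of_all _ fun x => (hv x).mul_const _)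
    rw [norm_mul, mul_comm]
    exact mul_le_mul_of_nonneg_left (hvb k x) (abs_nonneg _)
  obtain ⟨hz, hz'⟩ := key (fun k => (h k).1) hb hvb hv
  obtain ⟨hg, hg'⟩ := key (fun k => (h k).2.1) hc hfc hf
  refine ⟨hz, hg, fun φ hφ => ?_⟩
  refine tendsto_nhds_unique (hz' _ (isTestFunction_lap hφ)) ((hg' φ hφ).congr fun k => ?_)
  exact ((h k).2.2 φ hφ).symm

/-- Existence between ordered barriers: if `Δu₊ ≤ w(e^{u₊} - 1) - r` and
`Δu₋ ≥ w(e^{u₋} - 1) - r` with `u₋ ≤ u₊` square integrable and `u₊` bounded above, then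
`Δu = w(e^u - 1) - r` has a solution. It is the limit of the iteration
`v ↦ (κ - Δ)⁻¹(κv - w(e^v - 1) + r)`, which is monotone when `κ` dominates the slope of the
nonlinearity. -/
theorem exists_solution_of_barriers {w r um up gm gp : Plane → ℝ} {M : ℝ} (hM : 0 ≤ M)
    (hw : AEStronglyMeasurable w volume) (hw0 : ∀ x, 0 ≤ w x) (hw1 : ∀ x, w x ≤ 1)
    (hr : MemLp r 2 volume) (humc : Continuous um) (hupc : Continuous up)
    (hum : MemLp um 2 volume) (hup : MemLp up 2 volume)
    (hupM : ∀ x, up x ≤ M) (hle : ∀ x, um x ≤ up x)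
    (hgm : HasWeakLaplacian um gm) (hgp : HasWeakLaplacian up gp)
    (hm : ∀ x, w x * (Real.exp (um x) - 1) - r x ≤ gm x)
    (hp : ∀ x, gp x ≤ w x * (Real.exp (up x) - 1) - r x) :
    ∃ u : Plane → ℝ, Continuous u ∧ Tendsto u (cocompact Plane) (𝓝 0) ∧ MemW12 u ∧
      IsWeakSolution u (fun x => w x * (Real.exp (u x) - 1) - r x) := by
  set κ := Real.exp M with hκ_def
  have hκ : 0 < κ := Real.exp_pos M
  choose! R hR using fun (ρ : Plane → ℝ) (hρ : MemLp ρ 2 volume) => exists_resolvent hκ hρ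
  have Rlap : ∀ {ρ}, MemLp ρ 2 volume → HasWeakLaplacian (R ρ) (fun x => κ * R ρ x - ρ x) :=
    fun hρ => (hR _ hρ).2.2.2.2.1.hasWeakLaplacian
  have RL2 : ∀ {ρ}, MemLp ρ 2 volume → MemLp (R ρ) 2 volume := fun hρ => (hR _ hρ).2.2.1
  set N : (Plane → ℝ) → Plane → ℝ :=
    fun v x => κ * v x - (w x * (Real.exp (v x) - 1) - r x) with hN
  have hexp : ∀ {v : Plane → ℝ} (x : Plane), v x ≤ M →
      |w x * (Real.exp (v x) - 1)| ≤ κ * |v x| := fun x hx => by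
    rw [abs_mul, abs_of_nonneg (hw0 x)]
    exact (mul_le_of_le_one_left (abs_nonneg _) (hw1 x)).trans (abs_exp_sub_one_le hM hx)
  have hNL2 : ∀ {v : Plane → ℝ}, MemLp v 2 volume → (∀ x, v x ≤ M) → MemLp (N v) 2 volume := by
    intro v hv hvM
    refine (hv.const_mul κ).sub (MemLp.sub ?_ hr)
    exact hv.of_le_mul (hw.mul ((Real.continuous_exp.comp_aestronglyMeasurable hv.1).sub
      aestronglyMeasurable_const)) (ae_of_all _ fun x => hexp x (hvM x))
  have hNmono : ∀ {v v' : Plane → ℝ}, (∀ x, v' x ≤ M) → (∀ x, v x ≤ v' x) →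
      ∀ x, N v x ≤ N v' x := by
    intro v v' hv' hvv x
    have h1 := exp_sub_exp_le (hvv x) (hv' x)
    have h2 : w x * (Real.exp (v' x) - Real.exp (v x)) ≤ κ * (v' x - v x) :=
      (mul_le_of_le_one_left (sub_nonneg.2 (Real.exp_le_exp.2 (hvv x))) (hw1 x)).trans h1
    simp only [hN]; linarith
  have hRmono : ∀ {ρ ρ' : Plane → ℝ}, MemLp ρ 2 volume → MemLp ρ' 2 volume → (∀ x, ρ x ≤ ρ' x) →
      ∀ x, R ρ x ≤ R ρ' x := by
    intro ρ ρ' h h' hl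
    refine le_of_ae_le (hR _ h).1 (hR _ h').1 ((Rlap h).ae_le (Rlap h') (RL2 h) (RL2 h')
      (ae_of_all _ fun x hx => ?_))
    linarith [hl x, mul_lt_mul_of_pos_left hx hκ]
  set b : Plane → ℝ := fun x => |um x| + |up x| with hb
  have hb2 : MemLp b 2 volume := hum.abs.add hup.abs
  have hbd : ∀ {v : Plane → ℝ} (x : Plane), um x ≤ v x → v x ≤ up x → |v x| ≤ b x := by
    intro v x h1 h2
    rw [abs_le]
    constructor
    · linarith [neg_abs_le (um x), abs_nonneg (up x)]
    · linarith [le_abs_self (up x), abs_nonneg (um x)]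
  have humM : ∀ x, um x ≤ M := fun x => (hle x).trans (hupM x)
  have hstart : ∀ x, um x ≤ R (N um) x := by
    have h := hNL2 hum humM
    refine le_of_ae_le humc (hR _ h).1 (hgm.ae_le (Rlap h) hum (RL2 h)
      (ae_of_all _ fun x hx => ?_))
    have := hm x
    have := mul_lt_mul_of_pos_left hx hκ
    simp only [hN] at this ⊢
    linarith
  have hend : ∀ x, R (N up) x ≤ up x := by
    have h := hNL2 hup hupM
    refine le_of_ae_le (hR _ h).1 hupc ((Rlap h).ae_le hgp (RL2 h) hup
      (ae_of_all _ fun x hx => ?_))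
    have := hp x
    have := mul_lt_mul_of_pos_left hx hκ
    simp only [hN] at this ⊢
    linarith
  set v : ℕ → Plane → ℝ := fun k => (fun f => R (N f))^[k] um with hv
  have hvs : ∀ k, v (k + 1) = R (N (v k)) := fun k => Function.iterate_succ_apply' _ _ _
  have hinv : ∀ k, MemLp (v k) 2 volume ∧ (∀ x, um x ≤ v k x) ∧ (∀ x, v k x ≤ up x) ∧
      ∀ x, v k x ≤ v (k + 1) x := by
    intro k
    induction k with
    | zero => exact ⟨hum, fun x => le_rfl, hle, hstart⟩
    | succ k ih =>
      obtain ⟨i1, i2, i3, i4⟩ := ih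
      have iM : ∀ x, v k x ≤ M := fun x => (i3 x).trans (hupM x)
      have j1 : MemLp (v (k + 1)) 2 volume := by rw [hvs]; exact RL2 (hNL2 i1 iM)
      have j3 : ∀ x, v (k + 1) x ≤ up x := fun x => by
        rw [hvs]
        exact (hRmono (hNL2 i1 iM) (hNL2 hup hupM) (hNmono hupM i3) x).trans (hend x)
      have jM : ∀ x, v (k + 1) x ≤ M := fun x => (j3 x).trans (hupM x)
      refine ⟨j1, fun x => (i2 x).trans (i4 x), j3, fun x => ?_⟩
      rw [hvs (k + 1)]
      conv_lhs => rw [hvs k]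
      exact hRmono (hNL2 i1 iM) (hNL2 j1 jM) (hNmono jM i4) x
  have hvM : ∀ k x, v k x ≤ M := fun k x => ((hinv k).2.2.1 x).trans (hupM x)
  set z : Plane → ℝ := fun x => ⨆ k, v k x with hz
  have hvz : ∀ x, Tendsto (fun k => v k x) atTop (𝓝 (z x)) := fun x =>
    tendsto_atTop_ciSup (monotone_nat_of_le_succ fun k => (hinv k).2.2.2 x)
      ⟨up x, by rintro _ ⟨k, rfl⟩; exact (hinv k).2.2.1 x⟩
  have hzm : ∀ x, um x ≤ z x := fun x => ge_of_tendsto' (hvz x) fun k => (hinv k).2.1 x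
  have hzp : ∀ x, z x ≤ up x := fun x => le_of_tendsto' (hvz x) fun k => (hinv k).2.2.1 x
  have hzM : ∀ x, z x ≤ M := fun x => (hzp x).trans (hupM x)
  have hz2 : MemLp z 2 volume := hb2.mono
    (aestronglyMeasurable_of_tendsto_ae atTop (fun k => (hinv k).1.1) (ae_of_all _ hvz))
    (ae_of_all _ fun x => (hbd x (hzm x) (hzp x)).trans (le_abs_self _))
  have hNz := hNL2 hz2 hzM
  have hzlap : HasWeakLaplacian z (fun x => κ * z x - N z x) := by
    have hstep : ∀ k, HasWeakLaplacian (v (k + 1)) (fun x => κ * v (k + 1) x - N (v k) x) :=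
      fun k => by rw [hvs]; exact Rlap (hNL2 (hinv k).1 (hvM k))
    refine hasWeakLaplacian_of_tendsto hstep (hb2.locallyIntegrable (by norm_num))
      (c := fun x => 3 * κ * b x + |r x|)
      (((hb2.const_mul (3 * κ)).add hr.abs).locallyIntegrable (by norm_num))
      (fun k x => hbd x ((hinv (k + 1)).2.1 x) ((hinv (k + 1)).2.2.1 x)) (fun k x => ?_)
      (fun x => (hvz x).comp (tendsto_add_atTop_nat 1)) (fun x => ?_)
    · have b1 := hbd x ((hinv (k + 1)).2.1 x) ((hinv (k + 1)).2.2.1 x)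
      have b2 := hbd x ((hinv k).2.1 x) ((hinv k).2.2.1 x)
      exact abs_sub_sub_le hκ.le b1 b2
        ((hexp x (hvM k x)).trans (mul_le_mul_of_nonneg_left b2 hκ.le))
    · have t1 := ((hvz x).comp (tendsto_add_atTop_nat 1)).const_mul κ
      have t2 := (hvz x).const_mul κ
      have t3 := ((((Real.continuous_exp.tendsto _).comp (hvz x)).sub_const 1).const_mul
        (w x)).sub_const (r x)
      exact t1.sub (t2.sub t3)
  have hu := hR _ hNz
  have huz : ∀ᵐ x, R (N z) x = z x := by
    have a1 := (Rlap hNz).ae_le hzlap hu.2.2.1 hz2 (ae_of_all _ fun x hx => by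
      linarith [mul_lt_mul_of_pos_left hx hκ])
    have a2 := hzlap.ae_le (Rlap hNz) hz2 hu.2.2.1 (ae_of_all _ fun x hx => by
      linarith [mul_lt_mul_of_pos_left hx hκ])
    filter_upwards [a1, a2] with x h1 h2 using le_antisymm h1 h2
  refine ⟨R (N z), hu.1, hu.2.1, hu.2.2.2.1, hu.2.2.2.2.1.congr ?_⟩
  filter_upwards [huz] with x hx
  rw [hx]
  simp only [hN]
  ring

/-- Existence for a potential `0 ≤ w ≤ 1` tending to `1` in the `L²` sense and an arbitrary square
integrable source `r`. -/
theorem exists_solution {w r : Plane → ℝ} (hw : Measurable w) (hw0 : ∀ x, 0 ≤ w x)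
    (hw1 : ∀ x, w x ≤ 1) (hw2 : MemLp (fun x => 1 - w x) 2 volume) (hr : MemLp r 2 volume) :
    ∃ u : Plane → ℝ, Continuous u ∧ Tendsto u (cocompact Plane) (𝓝 0) ∧ MemW12 u ∧
      IsWeakSolution u (fun x => w x * (Real.exp (u x) - 1) - r x) := by
  set B : Set Plane := {x | w x < 1 / 2} with hB_def
  have hBm : MeasurableSet B := measurableSet_lt hw measurable_const
  have hB : MemLp (B.indicator (fun _ => (1 : ℝ))) 2 volume := by
    refine hw2.of_le_mul (c := 2) (measurable_const.indicator hBm).aestronglyMeasurable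
      (ae_of_all _ fun x => ?_)
    rw [Real.norm_of_nonneg (sub_nonneg.2 (hw1 x))]
    by_cases hx : x ∈ B
    · rw [Set.indicator_of_mem hx, norm_one]
      have : w x < 1 / 2 := hx
      linarith
    · rw [Set.indicator_of_notMem hx, norm_zero]
      linarith [hw1 x]
  have hrp : MemLp (fun x => max (r x) 0) 2 volume := hr.pos_part
  have hrn : MemLp (fun x => max (-r x) 0) 2 volume := hr.neg_part
  obtain ⟨ε, s, y, hε, hεs, hyc, hy2, hy0, hys, hyl⟩ :=
    exists_barrier hrp (fun x => le_max_right _ _) hB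
  obtain ⟨ε', s', y', hε', hεs', hyc', hy2', hy0', hys', hyl'⟩ :=
    exists_barrier hrn (fun x => le_max_right _ _) hB
  have hs : 0 ≤ s := (mul_nonneg hε.le (hy0 0)).trans (hys 0)
  -- supersolution `y = (ε - Δ)⁻¹(r⁺ + s 1_B)`, subsolution `-y' = -(ε' - Δ)⁻¹(r⁻ + s' 1_B)`
  refine exists_solution_of_barriers (um := fun x => -1 * y' x) (up := y) (M := s / ε)
    (div_nonneg hs hε.le) hw.aestronglyMeasurable hw0 hw1 hr (continuous_const.mul hyc') hyc
    (hy2'.const_mul _) hy2 (fun x => ?_) (fun x => ?_) (hyl'.const_mul (-1)) hyl (fun x => ?_)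
    (fun x => ?_)
  · rw [le_div_iff₀ hε, mul_comm]; exact hys x
  · linarith [hy0 x, hy0' x]
  · have e0 := hy0' x
    have e1 := hys' x
    have e2 : Real.exp (-1 * y' x) ≤ 1 := Real.exp_le_one_iff.2 (by linarith)
    have e3 := le_max_left (-r x) 0
    by_cases hx : x ∈ B
    · rw [Set.indicator_of_mem hx]
      have := mul_nonneg (hw0 x) (sub_nonneg.2 e2)
      linarith
    · rw [Set.indicator_of_notMem hx]
      have hwx : 1 / 2 ≤ w x := not_lt.1 hx
      -- `1 - e^{-y} ≥ y / (1 + y)`, and `ε(1 + y) ≤ 1/2`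
      have e4 : Real.exp (-1 * y' x) * (1 + y' x) ≤ 1 := by
        have h1 := Real.add_one_le_exp (y' x)
        have h2 : Real.exp (-1 * y' x) * Real.exp (y' x) = 1 := by
          rw [← Real.exp_add]; simp
        nlinarith [Real.exp_pos (-1 * y' x)]
      have e5 : 2 * (ε' * y' x) ≤ 1 - Real.exp (-1 * y' x) := by
        have h1 : 2 * (ε' * y' x) * (1 + y' x) ≤ y' x := by
          have : ε' * (1 + y' x) ≤ 1 / 2 := by linarith
          nlinarith
        have h2 : y' x ≤ (1 - Real.exp (-1 * y' x)) * (1 + y' x) := by linarith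
        exact le_of_mul_le_mul_right (h1.trans h2) (by linarith)
      have e6 : ε' * y' x ≤ w x * (1 - Real.exp (-1 * y' x)) := by
        nlinarith [sub_nonneg.2 e2]
      linarith
  · have e0 := hy0 x
    have e1 := hys x
    have e2 := Real.add_one_le_exp (y x)
    have e3 := le_max_left (r x) 0
    have e4 : w x * y x ≤ w x * (Real.exp (y x) - 1) :=
      mul_le_mul_of_nonneg_left (by linarith) (hw0 x)
    have e5 := mul_nonneg (hw0 x) e0
    by_cases hx : x ∈ B
    · rw [Set.indicator_of_mem hx]
      linarith
    · rw [Set.indicator_of_notMem hx]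
      have hwx : 1 / 2 ≤ w x := not_lt.1 hx
      have : ε * y x ≤ w x * y x := mul_le_mul_of_nonneg_right (by linarith) e0
      linarith

/-! ### The vortex background -/

theorem memLp_div_norm_sq_add {lam : ℝ} (hlam : 0 < lam) (a : Plane) :
    MemLp (fun x : Plane => lam / (‖x - a‖ ^ 2 + lam)) 2 volume := by
  have h1 : (0 : ℝ) < (2 * Real.pi) ^ 2 * lam := by positivity
  have h2 := ((memLp_symb h1).const_mul ((2 * Real.pi) ^ 2 * lam)).comp_measurePreserving
    (measurePreserving_sub_right volume a)
  refine h2.ae_eq (ae_of_all _ fun x => ?_)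
  simp only [Function.comp, symb]
  have : ‖x - a‖ ^ 2 + lam ≠ 0 := by positivity
  field_simp
  ring

theorem exp_u₀ {n : ℕ} {lam : ℝ} (hlam : 0 < lam) (p : Fin n → Plane) (x : Plane) :
    Real.exp (u₀ lam p x) = (∏ a, (1 + lam / ‖x - p a‖ ^ 2))⁻¹ := by
  rw [u₀, Real.exp_neg, Real.exp_log (Finset.prod_pos fun a _ => by positivity)]

theorem one_le_prod_background {n : ℕ} {lam : ℝ} (hlam : 0 < lam) (p : Fin n → Plane)
    (x : Plane) (s : Finset (Fin n)) : 1 ≤ ∏ a ∈ s, (1 + lam / ‖x - p a‖ ^ 2) := by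
  refine Finset.prod_induction _ (fun c : ℝ => 1 ≤ c) (fun a b ha hb => ?_) le_rfl fun a _ => ?_
  · exact one_le_mul_of_one_le_of_one_le ha hb
  · have : 0 ≤ lam / ‖x - p a‖ ^ 2 := by positivity
    linarith

theorem one_sub_exp_u₀_le {n : ℕ} {lam : ℝ} (hlam : 0 < lam) (p : Fin n → Plane) (x : Plane) :
    1 - Real.exp (u₀ lam p x) ≤ ∑ a, lam / (‖x - p a‖ ^ 2 + lam) := by
  rw [exp_u₀ hlam]
  suffices h : ∀ s : Finset (Fin n), 1 - (∏ a ∈ s, (1 + lam / ‖x - p a‖ ^ 2))⁻¹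
      ≤ ∑ a ∈ s, lam / (‖x - p a‖ ^ 2 + lam) from h _
  intro s
  induction s using Finset.induction_on with
  | empty => simp
  | insert a s has ih =>
    rw [Finset.prod_insert has, Finset.sum_insert has, mul_inv]
    have h1 : 1 - (1 + lam / ‖x - p a‖ ^ 2)⁻¹ ≤ lam / (‖x - p a‖ ^ 2 + lam) := by
      -- at `x = p a` the quotient `lam / 0 = 0` makes the left-hand side vanish
      rcases eq_or_ne (‖x - p a‖) 0 with h0 | h0
      · rw [h0]; simp; positivity
      · apply le_of_eq
        have : ‖x - p a‖ ^ 2 + lam ≠ 0 := by positivity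
        field_simp
        ring
    have h2 := inv_le_one_of_one_le₀ (one_le_prod_background hlam p x s)
    have h3 : 0 ≤ (∏ a ∈ s, (1 + lam / ‖x - p a‖ ^ 2))⁻¹ :=
      inv_nonneg.2 (zero_le_one.trans (one_le_prod_background hlam p x s))
    have h4 : (1 + lam / ‖x - p a‖ ^ 2)⁻¹ ≤ 1 := inv_le_one_of_one_le₀ (by
      have : 0 ≤ lam / ‖x - p a‖ ^ 2 := by positivity
      linarith)
    nlinarith [mul_nonneg (sub_nonneg.2 h4) (sub_nonneg.2 h2)]

theorem measurable_exp_u₀ {n : ℕ} (lam : ℝ) (p : Fin n → Plane) :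
    Measurable fun x => Real.exp (u₀ lam p x) := by
  unfold u₀
  fun_prop

theorem memLp_g₀ {n : ℕ} {lam : ℝ} (hlam : 0 < lam) (p : Fin n → Plane) :
    MemLp (g₀ lam p) 2 volume := by
  refine memLp_finsetSum _ fun a _ => ?_
  refine (memLp_div_norm_sq_add hlam (p a)).of_le_mul (c := 4 / lam)
    (Measurable.aestronglyMeasurable (by fun_prop)) (ae_of_all _ fun x => ?_)
  rw [Real.norm_of_nonneg (by positivity), Real.norm_of_nonneg (by positivity)]
  have h1 : (0 : ℝ) < ‖x - p a‖ ^ 2 + lam := by positivity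
  have h2 : 4 / lam * (lam / (‖x - p a‖ ^ 2 + lam))
      = 4 * (‖x - p a‖ ^ 2 + lam) / (‖x - p a‖ ^ 2 + lam) ^ 2 := by
    field_simp
  rw [h2]
  gcongr
  nlinarith [sq_nonneg ‖x - p a‖]

theorem memLp_one_sub_exp_u₀ {n : ℕ} {lam : ℝ} (hlam : 0 < lam) (p : Fin n → Plane) :
    MemLp (fun x => 1 - Real.exp (u₀ lam p x)) 2 volume := by
  refine (memLp_finsetSum Finset.univ fun a _ => memLp_div_norm_sq_add hlam (p a)).mono
    (measurable_const.sub (measurable_exp_u₀ lam p)).aestronglyMeasurable (ae_of_all _ fun x => ?_)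
  have h1 : Real.exp (u₀ lam p x) ≤ 1 := by
    rw [exp_u₀ hlam]; exact inv_le_one_of_one_le₀ (one_le_prod_background hlam p x _)
  rw [Real.norm_of_nonneg (sub_nonneg.2 h1)]
  exact (one_sub_exp_u₀_le hlam p x).trans (le_abs_self _)

end BPSVortex

end

theorem theorem2 (n : ℕ) (p : Fin n → BPSVortex.Plane) (lam : ℝ) (hlam : 4 * (n : ℝ) < lam)
    (ς : BPSVortex.Plane → ℝ) (hς : MeasureTheory.MemLp ς 2 MeasureTheory.volume)
    (hς_lt : MeasureTheory.eLpNorm ς 2 MeasureTheory.volume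
      < ENNReal.ofReal (Real.sqrt (2 / Real.pi))) :
    ∃ u : BPSVortex.Plane → ℝ,
      BPSVortex.IsVortexSolution lam p ς u ∧
      Continuous u ∧
      Filter.Tendsto u (Filter.cocompact BPSVortex.Plane) (nhds 0) ∧
      ∀ v : BPSVortex.Plane → ℝ, BPSVortex.IsVortexSolution lam p ς v →
        v =ᵐ[MeasureTheory.volume] u := by
  have hl : 0 < lam := lt_of_le_of_lt (by positivity) hlam
  have hw1 : ∀ x, Real.exp (BPSVortex.u₀ lam p x) ≤ 1 := fun x => by
    rw [BPSVortex.exp_u₀ hl]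
    exact inv_le_one_of_one_le₀ (BPSVortex.one_le_prod_background hl p x _)
  have hw2 := BPSVortex.memLp_one_sub_exp_u₀ hl p
  obtain ⟨u, hc, ht, hu, hs⟩ := BPSVortex.exists_solution
    (BPSVortex.measurable_exp_u₀ lam p) (fun x => (Real.exp_pos _).le) hw1 hw2
    ((hw2.sub (BPSVortex.memLp_g₀ hl p)).add hς)
  have hsol : BPSVortex.IsVortexSolution lam p ς u := by
    refine ⟨hu, hs.congr (Filter.Eventually.of_forall fun x => ?_)⟩
    simp only [Pi.add_apply, Pi.sub_apply]
    rw [Real.exp_add]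
    ring
  -- the right-hand side is strictly increasing in the unknown
  have hle : ∀ {v v' : BPSVortex.Plane → ℝ}, BPSVortex.IsVortexSolution lam p ς v →
      BPSVortex.IsVortexSolution lam p ς v' → ∀ᵐ x, v x ≤ v' x := by
    intro v v' h h'
    refine h.2.hasWeakLaplacian.ae_le h'.2.hasWeakLaplacian h.1.1 h'.1.1
      (Filter.Eventually.of_forall fun x hx => ?_)
    have := Real.exp_lt_exp.2 (add_lt_add_left hx (BPSVortex.u₀ lam p x))
    linarith
  refine ⟨u, hsol, hc, ht, fun v hv => ?_⟩
  filter_upwards [hle hv hsol, hle hsol hv] with x h1 h2 using le_antisymm h1 h2
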